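/- A virtual link diagram is recorded by its classical crossings and the way their ends are connected (diagrams are taken up to detour moves), and is unoriented; welded links are virtual link diagrams up to Reidemeister moves, detour moves and the move exchanging two consecutive overcrossings of a strand. An $n$-move ($n\ge 1$) replaces two parallel strands by a row of $n$ half twists of the same handedness, or conversely; two welded links are $n$-move equivalent if they are related by finitely many $n$-moves. The associated core group $\Pi_L^{(2)}$ of a welded link $L$ has one generator for each arc of a diagram (an arc runs from underpass to underpass, disregarding virtual crossings, or is a closed curve without underpasses) and one relator $yx^{-1}yz^{-1}$ for each classical crossing with overpass $y$ and underpasses $x,z$. For a group $G$ let $\gamma_1G=G$ and $\gamma_{q+1}G=[\gamma_qG,G]$. The unreduced $n$th Burnside group $\widehat B_L(n)$ is the quotient of $\Pi_L^{(2)}$ by the normal subgroup generated by all $n$th powers, and $\widehat B_L^{2}(n)=\widehat B_L(n)/\gamma_2\widehat B_L(n)$. For a prime $p$, let $E^p$ be the Magnus expansion from the free group on $x_1,\dots,x_m$ to the formal power series in non-commuting variables $X_1,\dots,X_m$ over $\mathbb Z_p=\mathbb Z/p\mathbb Z$, $E^p(x_i)=1+X_i$; let $d(k)$ denote terms of degree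 $\ge k$. (0) $\Pi_L^{(2)}$ is, up to isomorphism, an invariant of the welded link $L$, and $\widehat B_L(n)$ is, up to isomorphism, preserved by $n$-moves. (1) Let $p$ be a prime and $L$ a welded link with $\Pi_L^{(2)}\cong\langle x_1,\dots,x_m\mid R\rangle$ and $\widehat B_L^{2}(p)\cong\mathbb Z_p^m$. If $L$ is $p$-move equivalent to a trivial link, then for every $r\in R$ $$E^p(r)=1+\sum_{(i_1,\dots,i_p)\in\{1,\dots,m\}^p}c(i_1,\dots,i_p)X_{i_1}\cdots X_{i_p}+d(p+1)$$ for some $c(i_1,\dots,i_p)\in\mathbb Z_p$ with $c(i_1,\dots,i_p)=c(i_{\sigma(1)},\dots,i_{\sigma(p)})$ for every permutation $\sigma$ of $\{1,\dots,p\}$. (2) Let $L$ be an $m$-component welded link with $\Pi_L^{(2)}\cong\langle x_1,\dots,x_m\mid R\rangle$. If $L$ is $4$-move equivalent to a trivial link, then for every $r\in R$ $$E^2(r)=1+\sum_{(i_1,\dots,i_4)\in\{1,\dots,m\}^4}c(i_1,i_2,i_3,i_4)X_{i_1}X_{i_2}X_{i_3}X_{i_4}+d(5)$$ for some $c(i_1,i_2,i_3,i_4)\in\mathbb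 Z_2$ with $c(i_1,\dots,i_4)=c(i_{\sigma(1)},\dots,i_{\sigma(4)})$ for every permutation $\sigma$ of $\{1,2,3,4\}$. (3) Label the initial arcs of a welded $4$-braid by $x_1,x_2,x_3,x_4$ and express the labels of the terminal arcs in these by means of the relations of the associated core group. Put $$Q_3=x_4x_1^{-1}x_2x_4^{-1}x_1x_2^{-1}x_3x_2^{-1}x_1x_4^{-1}x_2x_1^{-1}x_4 .$$ Let $b$ be the welded $4$-braid $(\sigma_2\sigma_1\tau_1\tau_2\sigma_3^{-1}\tau_3)^2$, where the strands are numbered from top to bottom and run from left to right, $\tau_i$ is the virtual crossing of the $i$th and $(i+1)$st strands, and in $\sigma_i$ (resp. $\sigma_i^{-1}$) the strand going from position $i$ to $i+1$ (resp. from $i+1$ to $i$) passes over. The terminal labels of $b$ are $x_1,x_2,Q_3,x_4$. For every welded $4$-braid $\beta$ with terminal labels $x_1,x_2,Q_3,x_4$ (in particular for $b$), the closure $\overline\beta$ satisfies $\Pi_{\overline\beta}^{(2)}\cong\langle x_1,x_2,x_3,x_4\mid Q_3x_3^{-1}\rangle$, and for every odd prime $p$ we have $\widehat B^2_{\overline\beta}(p)\cong\mathbb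 Z_p^4$ and $\overline\beta$ is not $p$-move equivalent to a trivial link. (4) For every odd prime $p$, the coefficient of $X_4X_2X_3$ in $E^p(Q_3x_3^{-1})$ is $1$ and that of $X_4X_3X_2$ is $0$. -/

import Mathlib

/-! ### Non-commutative formal power series and the Magnus expansion -/

/-- Formal power series with coefficients in `R` in non-commuting variables indexed by `σ`:
a series is the function sending a word (= a monomial `X_{i₁} ⋯ X_{iₖ}`) to its coefficient. -/
def NCSeries (σ R : Type*) := List σ → R

namespace NCSeries

variable {σ R : Type*}

@[ext] theorem ext {f g : NCSeries σ R} (h : ∀ w, f w = g w) : f = g := funext h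

/-- The series of the coefficients of the monomials that begin with `X_a`. -/
def tail (a : σ) (f : NCSeries σ R) : NCSeries σ R := fun w => f (a :: w)

theorem tail_apply (a : σ) (f : NCSeries σ R) (w : List σ) : tail a f w = f (a :: w) := rfl

variable [Ring R]

instance : AddCommGroup (NCSeries σ R) := inferInstanceAs (AddCommGroup (List σ → R))

instance : Module R (NCSeries σ R) := inferInstanceAs (Module R (List σ → R))

/-- The coefficient of a monomial. -/
def coeff (w : List σ) (f : NCSeries σ R) : R := f w

/-- The Cauchy product: sum over all factorizations `w = u ++ v`. -/
instance : Mul (NCSeries σ R) :=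
  ⟨fun f g w => ∑ k ∈ Finset.range (w.length + 1), f (w.take k) * g (w.drop k)⟩

open Classical in
instance : One (NCSeries σ R) := ⟨fun w => if w = [] then 1 else 0⟩

open Classical in
/-- The variable `X_i`. -/
noncomputable def X (i : σ) : NCSeries σ R := fun w => if w = [i] then 1 else 0

open Classical in
/-- The series `1 - X_i + X_i² - X_i³ + ⋯`. -/
noncomputable def altGeom (i : σ) : NCSeries σ R :=
  fun w => if ∀ j ∈ w, j = i then (-1) ^ w.length else 0

theorem add_apply (f g : NCSeries σ R) (w : List σ) : (f + g) w = f w + g w := rfl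

theorem zero_apply (w : List σ) : (0 : NCSeries σ R) w = 0 := rfl

theorem smul_apply (c : R) (f : NCSeries σ R) (w : List σ) : (c • f) w = c * f w := rfl

theorem mul_apply (f g : NCSeries σ R) (w : List σ) :
    (f * g) w = ∑ k ∈ Finset.range (w.length + 1), f (w.take k) * g (w.drop k) := rfl

theorem mul_nil (f g : NCSeries σ R) : (f * g) [] = f [] * g [] := by
  simp [mul_apply]

theorem mul_cons (f g : NCSeries σ R) (a : σ) (w : List σ) :
    (f * g) (a :: w) =
      f [] * g (a :: w) + (tail a f * g) w := by
  rw [mul_apply, mul_apply, List.length_cons, Finset.sum_range_succ', add_comm]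
  simp [tail_apply]

theorem one_nil : (1 : NCSeries σ R) [] = 1 := if_pos rfl

theorem one_cons (a : σ) (w : List σ) : (1 : NCSeries σ R) (a :: w) = 0 :=
  if_neg (List.cons_ne_nil a w)

protected theorem zero_mul (f : NCSeries σ R) : 0 * f = 0 := by
  ext w; simp [mul_apply, zero_apply]

protected theorem mul_zero (f : NCSeries σ R) : f * 0 = 0 := by
  ext w; simp [mul_apply, zero_apply]

protected theorem left_distrib (f g h : NCSeries σ R) : f * (g + h) = f * g + f * h := by
  ext w; simp [mul_apply, add_apply, _root_.mul_add, Finset.sum_add_distrib]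

protected theorem right_distrib (f g h : NCSeries σ R) : (f + g) * h = f * h + g * h := by
  ext w; simp [mul_apply, add_apply, add_mul, Finset.sum_add_distrib]

protected theorem smul_mul (c : R) (f g : NCSeries σ R) : (c • f) * g = c • (f * g) := by
  ext w; simp [mul_apply, smul_apply, Finset.mul_sum, mul_assoc]

protected theorem mul_assoc (f g h : NCSeries σ R) : f * g * h = f * (g * h) := by
  ext w
  induction w generalizing f with
  | nil => simp [mul_nil, mul_assoc]
  | cons a w ih =>
    have e : tail a (f * g) = f [] • tail a g + tail a f * g := by
      ext v; rw [tail_apply, mul_cons]; rfl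
    rw [mul_cons, mul_cons f, mul_cons g, e, NCSeries.right_distrib, add_apply, ih,
      NCSeries.smul_mul, smul_apply, mul_nil]
    simp only [mul_add, mul_assoc, add_assoc]

protected theorem one_mul (f : NCSeries σ R) : 1 * f = f := by
  ext w
  cases w with
  | nil => simp [mul_nil, one_nil]
  | cons a w =>
    have e : tail a (1 : NCSeries σ R) = 0 := by
      ext v; exact one_cons a v
    rw [mul_cons, e, NCSeries.zero_mul, one_nil, zero_apply, one_mul, add_zero]

protected theorem mul_one (f : NCSeries σ R) : f * 1 = f := by
  ext w
  induction w generalizing f with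
  | nil => simp [mul_nil, one_nil]
  | cons a w ih => rw [mul_cons, ih, one_cons, mul_zero, zero_add, tail_apply]

instance : Ring (NCSeries σ R) :=
  { (inferInstance : AddCommGroup (NCSeries σ R)) with
    mul := (· * ·)
    one := 1
    left_distrib := NCSeries.left_distrib
    right_distrib := NCSeries.right_distrib
    zero_mul := NCSeries.zero_mul
    mul_zero := NCSeries.mul_zero
    mul_assoc := NCSeries.mul_assoc
    one_mul := NCSeries.one_mul
    mul_one := NCSeries.mul_one }

theorem altGeom_nil (i : σ) : (altGeom i : NCSeries σ R) [] = 1 := by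
  simp [altGeom]

theorem altGeom_cons_self (i : σ) (w : List σ) :
    (altGeom i : NCSeries σ R) (i :: w) = -(altGeom i : NCSeries σ R) w := by
  by_cases h : ∀ j ∈ w, j = i
  · have h' : ∀ j ∈ i :: w, j = i := by simpa using h
    rw [altGeom, if_pos h', altGeom, if_pos h, List.length_cons, pow_succ, mul_neg_one]
  · have h' : ¬ ∀ j ∈ i :: w, j = i := by simpa using h
    rw [altGeom, if_neg h', altGeom, if_neg h, neg_zero]

theorem altGeom_cons_ne {i a : σ} (h : a ≠ i) (w : List σ) :
    (altGeom i : NCSeries σ R) (a :: w) = 0 := by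
  simp [altGeom, h]

theorem one_add_X_nil (i : σ) : (1 + X i : NCSeries σ R) [] = 1 := by
  simp [add_apply, one_nil, X]

theorem one_add_X_cons_self (i : σ) (w : List σ) :
    (1 + X i : NCSeries σ R) (i :: w) = (1 : NCSeries σ R) w := by
  rw [add_apply, one_cons, zero_add]
  cases w <;> simp [X, one_nil, one_cons]

theorem one_add_X_cons_ne {i a : σ} (h : a ≠ i) (w : List σ) :
    (1 + X i : NCSeries σ R) (a :: w) = 0 := by
  rw [add_apply, one_cons, zero_add]; simp [X, h]

theorem one_add_X_mul_altGeom (i : σ) : (1 + X i : NCSeries σ R) * altGeom i = 1 := by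
  ext w
  cases w with
  | nil => rw [mul_nil, one_add_X_nil, altGeom_nil, one_nil, mul_one]
  | cons a w =>
    rw [mul_cons, one_add_X_nil, one_mul, one_cons]
    by_cases h : a = i
    · subst h
      have e : tail a (1 + X a : NCSeries σ R) = 1 := by
        ext v; exact one_add_X_cons_self a v
      rw [e, one_mul, altGeom_cons_self, neg_add_cancel]
    · have e : tail a (1 + X i : NCSeries σ R) = 0 := by
        ext v; exact one_add_X_cons_ne h v
      rw [e, zero_mul, altGeom_cons_ne h, zero_apply, add_zero]

theorem altGeom_mul_one_add_X (i : σ) : altGeom i * (1 + X i : NCSeries σ R) = 1 := by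
  ext w
  induction w with
  | nil => rw [mul_nil, one_add_X_nil, altGeom_nil, one_nil, mul_one]
  | cons a w ih =>
    rw [mul_cons, altGeom_nil, one_mul, one_cons]
    by_cases h : a = i
    · subst h
      have e : tail a (altGeom a : NCSeries σ R)
          = (-1 : R) • altGeom a := by
        ext v; rw [tail_apply, altGeom_cons_self, smul_apply, neg_one_mul]
      rw [e, NCSeries.smul_mul, smul_apply, ih, one_add_X_cons_self, neg_one_mul, add_neg_cancel]
    · have e : tail a (altGeom i : NCSeries σ R) = 0 := by
        ext v; exact altGeom_cons_ne h v
      rw [e, zero_mul, one_add_X_cons_ne h, zero_apply, add_zero]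

/-- `1 + X_i` as a unit, with inverse `1 - X_i + X_i² - ⋯`. -/
noncomputable def unitOneAddX (i : σ) : (NCSeries σ R)ˣ where
  val := 1 + X i
  inv := altGeom i
  val_inv := one_add_X_mul_altGeom i
  inv_val := altGeom_mul_one_add_X i

end NCSeries

/-- The Magnus `ℤ_p`-expansion `E^p` of the free group on `x_1, …, x_m` (indexed by `Fin m`):
the homomorphism with `x_i ↦ 1 + X_i` and `x_i⁻¹ ↦ 1 - X_i + X_i² - ⋯`. -/
noncomputable def magnus (p m : ℕ) :
    FreeGroup (Fin m) →* (NCSeries (Fin m) (ZMod p))ˣ :=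
  FreeGroup.lift fun i => NCSeries.unitOneAddX i

/-- The series `f` has the form `1 + ∑ c(i_1,…,i_k) X_{i_1} ⋯ X_{i_k} + (terms of degree ≥ k+1)`,
the sum being over all `(i_1,…,i_k) ∈ {1,…,m}^k`, with coefficients `c` that are invariant under
all permutations of the `k` positions. -/
def HasSymmetricLeadingForm {m : ℕ} {R : Type*} [Ring R] (k : ℕ)
    (f : NCSeries (Fin m) R) : Prop :=
  ∃ (c : (Fin k → Fin m) → R) (d : NCSeries (Fin m) R),
    (∀ (s : Equiv.Perm (Fin k)) (i : Fin k → Fin m), c i = c (i ∘ s)) ∧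
    (∀ w : List (Fin m), w.length ≤ k → NCSeries.coeff w d = 0) ∧
    f = 1 + ∑ i : Fin k → Fin m,
          c i • (List.ofFn fun j => (NCSeries.X (i j) : NCSeries (Fin m) R)).prod + d

/-! ### Welded links

A virtual diagram is recorded by its planar-diagram code: the classical crossings, each with its
four incident edges in their cyclic order, and the way the edges are glued. Virtual crossings carry
no data: two virtual diagrams have the same code if and only if they differ by detour moves (and
planar isotopy). Diagrams are unoriented. -/

namespace Welded

/-- The pieces from which a diagram is assembled; edges are labelled by natural numbers.
* `crossing a b c d`: a classical crossing whose incident edges are `a, b, c, d` in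
  counterclockwise order, with `a, c` the two ends of the underpass and `b, d` the two ends of the
  overpass;
* `joint a b`: a point of a strand, away from crossings, where the edges `a` and `b` meet.
  (`joint a a` is a circle without classical crossings.) -/
inductive Piece where
  | crossing (a b c d : ℕ) : Piece
  | joint (a b : ℕ) : Piece

/-- The edge-ends at a piece. -/
def Piece.ends : Piece → Multiset ℕ
  | .crossing a b c d => {a, b, c, d}
  | .joint a b => {a, b}

/-- Rename the edges at a piece. -/
def Piece.rename (f : ℕ → ℕ) : Piece → Piece
  | .crossing a b c d => .crossing (f a) (f b) (f c) (f d)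
  | .joint a b => .joint (f a) (f b)

/-- All edge-ends of a family of pieces. -/
def edgeEnds (S : Multiset Piece) : Multiset ℕ := S.bind Piece.ends

/-- A (virtual, unoriented) link diagram: a finite family of pieces in which each edge that occurs
has exactly two ends. -/
structure Diagram where
  pieces : Multiset Piece
  closed : ∀ e ∈ edgeEnds pieces, (edgeEnds pieces).count e = 2

/-- The edges of a diagram. -/
def Diagram.Edge (D : Diagram) : Type := {e : ℕ // e ∈ edgeEnds D.pieces}

open Piece in
/-- Local moves generating welded equivalence, each inside an arbitrary remaining part `S` of the
diagram (moves are only ever applied between two diagrams, so that the edges which occur in the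
pictured part only are automatically distinct from each other and from all edges of `S`). -/
inductive WeldedMove : Multiset Piece → Multiset Piece → Prop
  /-- edges may be renamed -/
  | rename (f : ℕ → ℕ) (hf : Function.Injective f) (S : Multiset Piece) :
      WeldedMove S (S.map (Piece.rename f))
  /-- a crossing may be looked at after a half turn -/
  | rotate (a b c d : ℕ) (S : Multiset Piece) :
      WeldedMove (crossing a b c d ::ₘ S) (crossing c d a b ::ₘ S)
  /-- a joint has no direction -/
  | flip (a b : ℕ) (S : Multiset Piece) :
      WeldedMove (joint a b ::ₘ S) (joint b a ::ₘ S)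
  /-- a joint of two different edges may be erased: the two edges become one -/
  | merge (a b : ℕ) (hab : a ≠ b) (S : Multiset Piece) :
      WeldedMove (joint a b ::ₘ S) (S.map (Piece.rename fun e => if e = b then a else e))
  /-- first Reidemeister move, kink of one kind -/
  | R1 (a b c : ℕ) (S : Multiset Piece) :
      WeldedMove (crossing c c a b ::ₘ S) (joint a b ::ₘ S)
  /-- first Reidemeister move, kink of the other kind -/
  | R1' (a b c : ℕ) (S : Multiset Piece) :
      WeldedMove (crossing a c c b ::ₘ S) (joint a b ::ₘ S)
  /-- second Reidemeister move: the strand `a, m, b` passes over the strand `c, n, d` twice -/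
  | R2 (a b c d m n : ℕ) (S : Multiset Piece) :
      WeldedMove (crossing c m n a ::ₘ crossing n m d b ::ₘ S) (joint a b ::ₘ joint c d ::ₘ S)
  /-- third Reidemeister move: the top strand `t₁, t, t₂` is pushed across the crossing of the
  middle strand `m₁, m, m₂` with the bottom strand `b₁, b, b₂` -/
  | R3 (t₁ t t₂ m₁ m m₂ b₁ b b₂ : ℕ) (S : Multiset Piece) :
      WeldedMove
        (crossing m₁ t m t₁ ::ₘ crossing b₁ t₂ b t ::ₘ crossing b m₂ b₂ m ::ₘ S)
        (crossing b₁ m b m₁ ::ₘ crossing b t b₂ t₁ ::ₘ crossing m t₂ m₂ t ::ₘ S)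
  /-- third Reidemeister move, reflected picture -/
  | R3' (t₁ t t₂ m₁ m m₂ b₁ b b₂ : ℕ) (S : Multiset Piece) :
      WeldedMove
        (crossing m₁ t₁ m t ::ₘ crossing b₁ t b t₂ ::ₘ crossing b m b₂ m₂ ::ₘ S)
        (crossing b₁ m₁ b m ::ₘ crossing b t₁ b₂ t ::ₘ crossing m t m₂ t₂ ::ₘ S)
  /-- overcrossings commute: along the strand `a, e, b`, the overpass above the strand `c, c'` and
  the overpass above the strand `d, d'` change places (exchanging the names `c, c'` or the names
  `d, d'` gives all crossing signs) -/
  | OC (a e b c c' d d' : ℕ) (S : Multiset Piece) :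
      WeldedMove
        (crossing c a c' e ::ₘ crossing d e d' b ::ₘ S)
        (crossing d a d' e ::ₘ crossing c e c' b ::ₘ S)

/-- The row of `n` half twists, all of the same handedness, on two strands running from left to
right: after `i` half twists the upper edge is `u i` and the lower edge is `l i`. In each half twist
the strand going down passes over the strand going up. -/
def twist (n : ℕ) (u l : ℕ → ℕ) : Multiset Piece :=
  (Multiset.range n).map fun i => .crossing (l i) (l (i + 1)) (u (i + 1)) (u i)

/-- The `n`-move: a row of `n` half twists on two strands is replaced by two parallel strands.
(The row of opposite handedness may be replaced as well, up to second Reidemeister moves: insert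
both rows next to each other and remove the given one.) -/
inductive NMove (n : ℕ) : Multiset Piece → Multiset Piece → Prop
  | mk (hn : 0 < n) (u l : ℕ → ℕ) (S : Multiset Piece) :
      NMove n (twist n u l + S) (.joint (u 0) (u n) ::ₘ .joint (l 0) (l n) ::ₘ S)

/-- Two diagrams represent the same welded link. -/
def WeldedEquiv : Diagram → Diagram → Prop :=
  Relation.EqvGen fun D D' => WeldedMove D.pieces D'.pieces

/-- The welded links represented by two diagrams are `n`-move equivalent. -/
def NMoveEquiv (n : ℕ) : Diagram → Diagram → Prop :=
  Relation.EqvGen fun D D' => WeldedMove D.pieces D'.pieces ∨ NMove n D.pieces D'.pieces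

theorem edgeEnds_add (S T : Multiset Piece) : edgeEnds (S + T) = edgeEnds S + edgeEnds T :=
  Multiset.add_bind S T Piece.ends

/-- The trivial link diagram with `k` components: `k` circles without crossings. -/
def unlink (k : ℕ) : Diagram where
  pieces := (Multiset.range k).map fun i => .joint i i
  closed := by
    have h : edgeEnds ((Multiset.range k).map fun i => Piece.joint i i)
        = Multiset.range k + Multiset.range k := by
      induction k with
      | zero => rfl
      | succ k ih =>
        rw [Multiset.range_succ, Multiset.map_cons, edgeEnds, Multiset.cons_bind]
        rw [edgeEnds] at ih
        rw [ih]
        ext e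
        simp only [Piece.ends, Multiset.insert_eq_cons, Multiset.count_add, Multiset.count_cons,
          Multiset.count_singleton]
        omega
    intro e he
    rw [h] at he ⊢
    have he' : e ∈ Multiset.range k := by simpa using he
    rw [Multiset.count_add, Multiset.count_eq_one_of_mem (Multiset.nodup_range k) he']

/-- The welded link of `D` is `n`-move equivalent to a trivial link. -/
def NMoveTrivial (n : ℕ) (D : Diagram) : Prop := ∃ k : ℕ, NMoveEquiv n D (unlink k)

/-- Two edges are consecutive on a component: they are opposite at a crossing, or meet at a
joint. -/
def Diagram.Consecutive (D : Diagram) (e e' : D.Edge) : Prop :=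
  (∃ b d, Piece.crossing e.1 b e'.1 d ∈ D.pieces) ∨
  (∃ a c, Piece.crossing a e.1 c e'.1 ∈ D.pieces) ∨
  Piece.joint e.1 e'.1 ∈ D.pieces

/-- The number of components of the link. -/
noncomputable def Diagram.numComponents (D : Diagram) : ℕ := Nat.card (Quot D.Consecutive)

/-! ### The associated core group and Burnside groups -/

open FreeGroup in
/-- Relators of the associated core group on the edges: edges of the same arc (joined at a joint or
on the two sides of an overpass) are identified, and an underpass `x, z` below `y` gives
`y x⁻¹ y z⁻¹`. -/
inductive Diagram.CoreRel (D : Diagram) : FreeGroup D.Edge → Prop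
  | joint (e e' : D.Edge) (h : Piece.joint e.1 e'.1 ∈ D.pieces) :
      D.CoreRel (of e * (of e')⁻¹)
  | over (x y z y' : D.Edge) (h : Piece.crossing x.1 y.1 z.1 y'.1 ∈ D.pieces) :
      D.CoreRel (of y * (of y')⁻¹)
  | under (x y z y' : D.Edge) (h : Piece.crossing x.1 y.1 z.1 y'.1 ∈ D.pieces) :
      D.CoreRel (of y * (of x)⁻¹ * of y * (of z)⁻¹)

/-- The associated core group `Π_D^{(2)}`. -/
abbrev CoreGroup (D : Diagram) : Type := PresentedGroup {r | D.CoreRel r}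

/-- `G` modulo the normal subgroup generated by all `n`-th powers: if `G = ⟨x₁,…,x_m ∣ R⟩`, this is
`⟨x₁,…,x_m ∣ R, W_n⟩` with `W_n` the set of all `w ^ n`. -/
abbrev ModPowers (n : ℕ) (G : Type*) [Group G] : Type _ :=
  G ⧸ Subgroup.normalClosure (Set.range fun g : G => g ^ n)

/-- The unreduced `n`-th Burnside group. -/
abbrev BurnsideGroup (n : ℕ) (D : Diagram) : Type := ModPowers n (CoreGroup D)

/-- The quotient by the second term `γ₂ = [G, G]` of the lower central series of the unreduced
`n`-th Burnside group `G`. (Mathlib's indexing of the series starts at `0`.) -/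
abbrev BurnsideGroup₂ (n : ℕ) (D : Diagram) : Type :=
  BurnsideGroup n D ⧸ (⊤ : Subgroup (BurnsideGroup n D)).lowerCentralSeries 1

/-! ### Welded braids and their closures -/

/-- Letters of welded braid words on `n + 1` strands, numbered from top to bottom and running from
left to right. In `sigma i` the strand going down from position `i` to `i + 1` passes over, in
`sigmaInv i` the strand going up from position `i + 1` to `i` passes over; `tau i` is a virtual
crossing. -/
inductive BraidLetter (n : ℕ) where
  | sigma (i : Fin n) : BraidLetter n
  | sigmaInv (i : Fin n) : BraidLetter n
  | tau (i : Fin n) : BraidLetter n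

/-- The position of the upper one of the two strands that meet. -/
def BraidLetter.index {n : ℕ} : BraidLetter n → Fin n
  | .sigma i => i
  | .sigmaInv i => i
  | .tau i => i

/-- The edge at position `j` in the diagram of a braid on `n + 1` strands after `t` letters. -/
def braidEdge {n : ℕ} (t : ℕ) (j : Fin (n + 1)) : ℕ := t * (n + 1) + j

/-- The two strands that meet at the letter number `t + 1`. -/
def letterPieces {n : ℕ} (t : ℕ) : BraidLetter n → Multiset Piece
  | .sigma i =>
      {.crossing (braidEdge t i.succ) (braidEdge (t + 1) i.succ)
        (braidEdge (t + 1) i.castSucc) (braidEdge t i.castSucc)}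
  | .sigmaInv i =>
      {.crossing (braidEdge t i.castSucc) (braidEdge t i.succ)
        (braidEdge (t + 1) i.succ) (braidEdge (t + 1) i.castSucc)}
  | .tau i =>
      {.joint (braidEdge t i.castSucc) (braidEdge (t + 1) i.succ),
        .joint (braidEdge t i.succ) (braidEdge (t + 1) i.castSucc)}

/-- The strands that go straight on at the letter number `t + 1`. -/
def straightPieces {n : ℕ} (t : ℕ) (i : Fin n) : Multiset Piece :=
  ((Finset.univ : Finset (Fin (n + 1))).erase i.castSucc |>.erase i.succ).val.map
    fun j => .joint (braidEdge t j) (braidEdge (t + 1) j)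

/-- The pieces of the closure of a braid word, from the letter number `t + 1` on; at the end, the
terminal edges are joined to the initial ones. -/
def closurePieces {n : ℕ} : ℕ → List (BraidLetter n) → Multiset Piece
  | t, [] => (Finset.univ : Finset (Fin (n + 1))).val.map
      fun j => .joint (braidEdge t j) (braidEdge 0 j)
  | t, g :: w => letterPieces t g + straightPieces t g.index + closurePieces (t + 1) w

/-- The edges in column `t`. -/
def column (n t : ℕ) : Multiset ℕ :=
  (Finset.univ : Finset (Fin (n + 1))).val.map (braidEdge t)

theorem edgeEnds_map_joint {ι : Type*} (s : Multiset ι) (f g : ι → ℕ) :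
    edgeEnds (s.map fun j => Piece.joint (f j) (g j)) = s.map f + s.map g := by
  induction s using Multiset.induction_on with
  | empty => rfl
  | cons a s ih =>
    rw [edgeEnds] at ih
    rw [Multiset.map_cons, edgeEnds, Multiset.cons_bind, ih]
    ext e
    simp only [Piece.ends, Multiset.insert_eq_cons, Multiset.count_add, Multiset.count_cons,
      Multiset.count_singleton, Multiset.map_cons]
    omega

theorem column_eq {n : ℕ} (t : ℕ) (i : Fin n) :
    column n t = braidEdge t i.castSucc ::ₘ braidEdge t i.succ ::ₘ
      ((Finset.univ : Finset (Fin (n + 1))).erase i.castSucc |>.erase i.succ).val.map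
        (braidEdge t) := by
  have h1 : i.castSucc ∈ (Finset.univ : Finset (Fin (n + 1))) := Finset.mem_univ _
  have h2 : i.succ ∈ (Finset.univ : Finset (Fin (n + 1))).erase i.castSucc :=
    Finset.mem_erase.2 ⟨(Fin.castSucc_lt_succ (i := i)).ne', Finset.mem_univ _⟩
  have e2 := Multiset.cons_erase (show i.succ ∈ (Finset.univ.erase i.castSucc).val from h2)
  have e1 := Multiset.cons_erase (show i.castSucc ∈ (Finset.univ : Finset (Fin (n + 1))).val from h1)
  rw [column, ← Multiset.map_cons, ← Multiset.map_cons, Finset.erase_val _ i.succ, e2,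
    Finset.erase_val, e1]

theorem edgeEnds_layer {n : ℕ} (t : ℕ) (g : BraidLetter n) :
    edgeEnds (letterPieces t g + straightPieces t g.index) = column n t + column n (t + 1) := by
  rw [edgeEnds_add, straightPieces, edgeEnds_map_joint, column_eq t g.index,
    column_eq (t + 1) g.index]
  cases g <;>
  · ext e
    simp only [letterPieces, edgeEnds, Multiset.insert_eq_cons, Multiset.cons_bind,
      Multiset.singleton_bind, Piece.ends, Multiset.count_add, Multiset.count_cons,
      Multiset.count_singleton, BraidLetter.index]
    omega

/-- The edges in the columns from `t` to `t + k`. -/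
def columns (n : ℕ) : ℕ → ℕ → Multiset ℕ
  | t, 0 => column n t
  | t, k + 1 => column n t + columns n (t + 1) k

theorem column_le {n t e : ℕ} (h : e ∈ column n t) :
    t * (n + 1) ≤ e ∧ e < (t + 1) * (n + 1) := by
  obtain ⟨j, -, rfl⟩ := Multiset.mem_map.1 h
  have := j.2
  simp only [braidEdge, add_mul, one_mul]
  omega

theorem le_of_mem_columns {n k t e : ℕ} (h : e ∈ columns n t k) : t * (n + 1) ≤ e := by
  induction k generalizing t with
  | zero => exact (column_le h).1
  | succ k ih =>
    rcases Multiset.mem_add.1 h with h | h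
    · exact (column_le h).1
    · exact le_trans (Nat.mul_le_mul_right _ (Nat.le_succ t)) (ih h)

theorem nodup_column (n t : ℕ) : (column n t).Nodup := by
  refine Multiset.Nodup.map ?_ (Finset.nodup _)
  intro i j h
  have : t * (n + 1) + (i : ℕ) = t * (n + 1) + (j : ℕ) := h
  exact Fin.ext (by omega)

theorem nodup_columns (n k t : ℕ) : (columns n t k).Nodup := by
  induction k generalizing t with
  | zero => exact nodup_column n t
  | succ k ih =>
    refine Multiset.nodup_add.2 ⟨nodup_column n t, ih (t + 1), ?_⟩
    refine Multiset.disjoint_left.2 fun {e} h h' => ?_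
    exact absurd (column_le h).2 (not_lt.2 (le_of_mem_columns h'))

theorem edgeEnds_closurePieces {n : ℕ} (w : List (BraidLetter n)) (t : ℕ) :
    edgeEnds (closurePieces t w) + column n t
      = columns n t w.length + columns n t w.length + column n 0 := by
  induction w generalizing t with
  | nil =>
    rw [closurePieces, edgeEnds_map_joint]
    change column n t + column n 0 + column n t = column n t + column n t + column n 0
    abel
  | cons g w ih =>
    have h := ih (t + 1)
    rw [closurePieces, edgeEnds_add, edgeEnds_layer]
    change column n t + column n (t + 1) + edgeEnds (closurePieces (t + 1) w) + column n t =
      (column n t + columns n (t + 1) w.length) + (column n t + columns n (t + 1) w.length)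
        + column n 0
    calc _ = column n t + column n t +
          (edgeEnds (closurePieces (t + 1) w) + column n (t + 1)) := by abel
      _ = _ := by rw [h]; abel

/-- The closure of a welded braid word. -/
def closure {n : ℕ} (w : List (BraidLetter n)) : Diagram where
  pieces := closurePieces 0 w
  closed := by
    have h : edgeEnds (closurePieces 0 w) = columns n 0 w.length + columns n 0 w.length :=
      add_right_cancel (edgeEnds_closurePieces w 0)
    intro e he
    rw [h] at he ⊢
    have he' : e ∈ columns n 0 w.length := by simpa using he
    rw [Multiset.count_add, Multiset.count_eq_one_of_mem (nodup_columns n _ 0) he']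

/-- How the labels (in some group) of the arcs at the `n + 1` positions change when passing one
letter, according to the relation `z = y x⁻¹ y` of the associated core group. -/
def BraidLetter.act {n : ℕ} {G : Type*} [Group G] (f : Fin (n + 1) → G) :
    BraidLetter n → Fin (n + 1) → G
  | .sigma i => Function.update (Function.update f i.succ (f i.castSucc))
      i.castSucc (f i.castSucc * (f i.succ)⁻¹ * f i.castSucc)
  | .sigmaInv i => Function.update (Function.update f i.castSucc (f i.succ))
      i.succ (f i.succ * (f i.castSucc)⁻¹ * f i.succ)
  | .tau i => Function.update (Function.update f i.castSucc (f i.succ))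
      i.succ (f i.castSucc)

/-- The labels of the terminal arcs of a welded braid whose initial arcs are labelled by the free
generators `x_1, …, x_{n+1}`, from top to bottom. -/
def terminalLabels {n : ℕ} (w : List (BraidLetter n)) : Fin (n + 1) → FreeGroup (Fin (n + 1)) :=
  w.foldl BraidLetter.act FreeGroup.of

open BraidLetter in
/-- The welded `4`-braid `(σ₂ σ₁ τ₁ τ₂ σ₃⁻¹ τ₃)²`: twice in succession, the third strand
passes under the second and the first one, and then, after virtual crossings with them,
under the fourth one, and returns to its place by a virtual crossing. -/
def braidB : List (BraidLetter 3) :=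
  [sigma 1, sigma 0, tau 0, tau 1, sigmaInv 2, tau 2,
   sigma 1, sigma 0, tau 0, tau 1, sigmaInv 2, tau 2]

open FreeGroup in
/-- The word `x₄x₁⁻¹x₂x₄⁻¹x₁x₂⁻¹ x₃ x₂⁻¹x₁x₄⁻¹x₂x₁⁻¹x₄` (indices are shifted by one). -/
def Q₃ : FreeGroup (Fin 4) :=
  of 3 * (of 0)⁻¹ * of 1 * (of 3)⁻¹ * of 0 * (of 1)⁻¹ * of 2 *
    (of 1)⁻¹ * of 0 * (of 3)⁻¹ * of 1 * (of 0)⁻¹ * of 3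

/-- The terminal labels `x₁, x₂, Q₃, x₄`. -/
def labelsB : Fin 4 → FreeGroup (Fin 4) :=
  ![FreeGroup.of 0, FreeGroup.of 1, Q₃, FreeGroup.of 3]

end Welded

/-! A homomorphism from the core group to a group `G` is a labelling of the edges by elements of `G`
that obeys the relation at each piece, so invariance becomes a bijection between labellings before
and after a local move. For welded moves this says that `(x, y) ↦ y * x⁻¹ * y` is an idempotent,
involutory, self-distributive operation. For the `n`-move, a half twist multiplies both labels on
the left by the same element `x = f (u 0) * (f (l 0))⁻¹`, so `n` half twists multiply by `x ^ n`,
which is `1` in a group of exponent `n` (`isColoring_twist`, `NMove.burnside`). The core group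
itself is the case `n = 0`.

The obstructions come from counting. If `D` is `n`-move equivalent to the `m`-component trivial
link, then for every finite group `H` of exponent `n` there are exactly `|H| ^ m` homomorphisms from
the core group to `H`. With a presentation on `m` generators these correspond to the `m`-tuples in
`H` that satisfy the relators, so every tuple satisfies them (`lift_eq_one_of_nMoveEquiv`). No
knowledge of the Burnside groups is needed.

The group `H` is the free group modulo `symmetricSubgroup`, the elements with `E^p(g) = 1 +`
(symmetric terms of degree `k`) `+ d(k + 1)`, where `k = p ^ a`. This subgroup is normal and of
finite index, and it contains all `k`-th powers: in characteristic `p`, `E(g) ^ k - 1 = (E(g) - 1) ^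
k`, whose coefficients in degree `k` are products of linear coefficients. Hence it contains the
relators. The number of components of the trivial link is matched with `m` by counting homomorphisms
to `ℤ_p`, or to `ℤ_2` for 4-moves.

A closed braid has the core group in which terminal labels are identified with initial ones. For the
labels `x₁, x₂, Q₃, x₄` the only relator left is `Q₃x₃⁻¹`; it dies in abelian groups, but its
coefficients at `X₄X₂X₃` and `X₄X₃X₂` differ. -/

namespace Welded

/-! ### Colourings -/

/-- The relations that a labelling of the edges by elements of a group has to satisfy at a
piece. -/
def Piece.IsColored {G : Type*} [Group G] (f : ℕ → G) : Piece → Prop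
  | .crossing x y z y' => f y = f y' ∧ f z = f y * (f x)⁻¹ * f y
  | .joint a b => f a = f b

/-- A labelling of the edges that satisfies the relations at all pieces. -/
def IsColoring {G : Type*} [Group G] (S : Multiset Piece) (f : ℕ → G) : Prop :=
  ∀ P ∈ S, P.IsColored f

section Coloring

variable {G H : Type*} [Group G] [Group H]

theorem isColoring_cons {P : Piece} {S : Multiset Piece} {f : ℕ → G} :
    IsColoring (P ::ₘ S) f ↔ P.IsColored f ∧ IsColoring S f := by
  simp [IsColoring]

theorem isColoring_add {S T : Multiset Piece} {f : ℕ → G} :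
    IsColoring (S + T) f ↔ IsColoring S f ∧ IsColoring T f := by
  simp [IsColoring, or_imp, forall_and]

theorem isColored_rename {P : Piece} {f : ℕ → G} (s : ℕ → ℕ) :
    (P.rename s).IsColored f ↔ P.IsColored (f ∘ s) := by
  cases P <;> rfl

theorem isColoring_rename {S : Multiset Piece} {f : ℕ → G} (s : ℕ → ℕ) :
    IsColoring (S.map (Piece.rename s)) f ↔ IsColoring S (f ∘ s) := by
  simp [IsColoring, isColored_rename]

theorem Piece.IsColored.map {P : Piece} {f : ℕ → G} (h : P.IsColored f) (φ : G →* H) :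
    P.IsColored (φ ∘ f) := by
  cases P with
  | crossing x y z y' =>
    obtain ⟨h1, h2⟩ := h
    exact ⟨congrArg φ h1, by simp [h2]⟩
  | joint a b => exact congrArg φ h

theorem IsColoring.map {S : Multiset Piece} {f : ℕ → G} (h : IsColoring S f) (φ : G →* H) :
    IsColoring S (φ ∘ f) := fun P hP => (h P hP).map φ

theorem Piece.IsColored.congr {P : Piece} {f g : ℕ → G} (h : P.IsColored f)
    (hfg : ∀ e ∈ P.ends, f e = g e) : P.IsColored g := by
  cases P with
  | crossing x y z y' =>
    simp only [Piece.ends, Multiset.insert_eq_cons, Multiset.mem_cons, Multiset.mem_singleton,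
      forall_eq_or_imp, forall_eq] at hfg
    obtain ⟨h1, h2⟩ := h
    obtain ⟨hx, hy, hz, hy'⟩ := hfg
    exact ⟨by rw [← hy, ← hy', h1], by rw [← hx, ← hy, ← hz, h2]⟩
  | joint a b =>
    simp only [Piece.ends, Multiset.insert_eq_cons, Multiset.mem_cons, Multiset.mem_singleton,
      forall_eq_or_imp, forall_eq] at hfg
    have h1 : f a = f b := h
    change g a = g b
    rw [← hfg.1, ← hfg.2, h1]

theorem mem_edgeEnds {S : Multiset Piece} {e : ℕ} : e ∈ edgeEnds S ↔ ∃ P ∈ S, e ∈ P.ends :=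
  Multiset.mem_bind

theorem edgeEnds_cons (P : Piece) (S : Multiset Piece) :
    edgeEnds (P ::ₘ S) = P.ends + edgeEnds S := Multiset.cons_bind _ _ _

theorem IsColoring.congr {S : Multiset Piece} {f g : ℕ → G} (h : IsColoring S f)
    (hfg : ∀ e ∈ edgeEnds S, f e = g e) : IsColoring S g :=
  fun P hP => (h P hP).congr fun e he => hfg e (mem_edgeEnds.2 ⟨P, hP, he⟩)

end Coloring

open Classical in
/-- The generator of the associated core group given by an edge. -/
noncomputable def Diagram.gen (D : Diagram) (e : ℕ) : CoreGroup D :=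
  -- The value `1` off the edges is a dummy: the relations at the pieces only see edges of `D`.
  if h : e ∈ edgeEnds D.pieces then PresentedGroup.of (⟨e, h⟩ : D.Edge) else 1

theorem Diagram.gen_coe (D : Diagram) (e : D.Edge) :
    D.gen e.1 = PresentedGroup.of e := dif_pos e.2

theorem Diagram.isColoring_gen (D : Diagram) : IsColoring D.pieces D.gen := by
  intro P hP
  have mem : ∀ e ∈ P.ends, e ∈ edgeEnds D.pieces := fun e he => mem_edgeEnds.2 ⟨P, hP, he⟩
  have one : ∀ {r}, D.CoreRel r → PresentedGroup.mk {r | D.CoreRel r} r = 1 := fun h =>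
    PresentedGroup.one_of_mem h
  cases P with
  | crossing x y z y' =>
    simp only [Piece.ends, Multiset.insert_eq_cons, Multiset.mem_cons, Multiset.mem_singleton,
      forall_eq_or_imp, forall_eq] at mem
    obtain ⟨hx, hy, hz, hy'⟩ := mem
    have h1 := one (Diagram.CoreRel.over ⟨x, hx⟩ ⟨y, hy⟩ ⟨z, hz⟩ ⟨y', hy'⟩ hP)
    have h2 := one (Diagram.CoreRel.under ⟨x, hx⟩ ⟨y, hy⟩ ⟨z, hz⟩ ⟨y', hy'⟩ hP)
    simp only [map_mul, map_inv] at h1 h2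
    constructor
    · simp only [Diagram.gen, hy, hy', dif_pos]
      exact mul_inv_eq_one.1 h1
    · simp only [Diagram.gen, hx, hy, hz, dif_pos]
      exact (mul_inv_eq_one.1 h2).symm
  | joint a b =>
    simp only [Piece.ends, Multiset.insert_eq_cons, Multiset.mem_cons, Multiset.mem_singleton,
      forall_eq_or_imp, forall_eq] at mem
    obtain ⟨ha, hb⟩ := mem
    have h1 := one (Diagram.CoreRel.joint ⟨a, ha⟩ ⟨b, hb⟩ hP)
    simp only [map_mul, map_inv] at h1
    change D.gen a = D.gen b
    simp only [Diagram.gen, ha, hb, dif_pos]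
    exact mul_inv_eq_one.1 h1

theorem IsColoring.lift_eq_one {D : Diagram} {G : Type*} [Group G] {f : ℕ → G}
    (h : IsColoring D.pieces f) :
    ∀ r ∈ {r | D.CoreRel r}, FreeGroup.lift (fun e : D.Edge => f e.1) r = 1 := by
  rintro r (⟨e, e', he⟩ | ⟨x, y, z, y', he⟩ | ⟨x, y, z, y', he⟩)
  · have h1 : f e.1 = f e'.1 := h _ he
    simp [h1]
  · have h1 : f y.1 = f y'.1 := (h _ he).1
    simp [h1]
  · have h1 : f z.1 = _ := (h _ he).2
    simp [h1, mul_assoc]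

/-- The homomorphism given by a colouring. -/
noncomputable def IsColoring.hom {D : Diagram} {G : Type*} [Group G] {f : ℕ → G}
    (h : IsColoring D.pieces f) : CoreGroup D →* G :=
  PresentedGroup.toGroup h.lift_eq_one

theorem IsColoring.hom_gen {D : Diagram} {G : Type*} [Group G] {f : ℕ → G}
    (h : IsColoring D.pieces f) {e : ℕ} (he : e ∈ edgeEnds D.pieces) : h.hom (D.gen e) = f e := by
  rw [Diagram.gen, dif_pos he]
  exact PresentedGroup.toGroup.of _

theorem CoreGroup.hom_ext {D : Diagram} {G : Type*} [Group G] {φ ψ : CoreGroup D →* G}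
    (h : ∀ e ∈ edgeEnds D.pieces, φ (D.gen e) = ψ (D.gen e)) : φ = ψ := by
  refine PresentedGroup.ext fun e => ?_
  rw [← D.gen_coe e]
  exact h e.1 e.2

/-! ### Killing powers -/

section ModPowers

variable {n : ℕ} {G H : Type*} [Group G] [Group H]

theorem ModPowers.pow_eq_one (x : ModPowers n G) : x ^ n = 1 := by
  obtain ⟨g, rfl⟩ := QuotientGroup.mk_surjective x
  rw [← QuotientGroup.mk_pow, QuotientGroup.eq_one_iff]
  exact Subgroup.subset_normalClosure ⟨g, rfl⟩

/-- Homomorphisms to groups of exponent `n` factor through the quotient by `n`-th powers. -/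
def ModPowers.lift (φ : G →* H) (hH : ∀ x : H, x ^ n = 1) : ModPowers n G →* H :=
  QuotientGroup.lift _ φ <| by
    refine Subgroup.normalClosure_le_normal ?_
    rintro _ ⟨g, rfl⟩
    simp [MonoidHom.mem_ker, hH]

/-- Homomorphisms to a group of exponent `n` are homomorphisms on the quotient by `n`-th
powers. -/
def ModPowers.homEquiv (hH : ∀ x : H, x ^ n = 1) : (ModPowers n G →* H) ≃ (G →* H) where
  toFun φ := φ.comp (QuotientGroup.mk' _)
  invFun φ := ModPowers.lift φ hH
  left_inv φ := by ext; rfl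
  right_inv φ := by ext; rfl

/-- Killing `0`-th powers changes nothing. -/
theorem ModPowers.nonempty_zero_mulEquiv : Nonempty (ModPowers 0 G ≃* G) := by
  refine ⟨MonoidHom.toMulEquiv (ModPowers.lift (MonoidHom.id G) fun x => pow_zero x)
    (QuotientGroup.mk' _) ?_ ?_⟩ <;> ext <;> rfl

end ModPowers

/-- The generator of the Burnside group given by an edge. -/
noncomputable def Diagram.bgen (n : ℕ) (D : Diagram) (e : ℕ) : BurnsideGroup n D :=
  QuotientGroup.mk' _ (D.gen e)

theorem Diagram.isColoring_bgen (n : ℕ) (D : Diagram) : IsColoring D.pieces (D.bgen n) :=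
  D.isColoring_gen.map (QuotientGroup.mk' _)

theorem IsColoring.exists_burnside_hom {n : ℕ} {D : Diagram} {G : Type*} [Group G] {f : ℕ → G}
    (h : IsColoring D.pieces f) (hG : ∀ x : G, x ^ n = 1) :
    ∃ φ : BurnsideGroup n D →* G, ∀ e ∈ edgeEnds D.pieces, φ (D.bgen n e) = f e :=
  ⟨ModPowers.lift h.hom hG, fun _ he => h.hom_gen he⟩

theorem BurnsideGroup.hom_ext {n : ℕ} {D : Diagram} {G : Type*} [Group G]
    {φ ψ : BurnsideGroup n D →* G}
    (h : ∀ e ∈ edgeEnds D.pieces, φ (D.bgen n e) = ψ (D.bgen n e)) : φ = ψ := by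
  refine QuotientGroup.monoidHom_ext _ ?_
  exact CoreGroup.hom_ext h

/-- If each colouring of `D` or `D'` by a group of exponent `n` is determined by its values on a
set of common edges, and these values extend to a colouring of the other diagram, then the Burnside
groups agree. -/
theorem burnside_mulEquiv_of_boundary {n : ℕ} {D D' : Diagram} (B : Set ℕ)
    (sub : ∀ e ∈ B, e ∈ edgeEnds D.pieces) (sub' : ∀ e ∈ B, e ∈ edgeEnds D'.pieces)
    (ext : ∀ (G : Type) [Group G], (∀ x : G, x ^ n = 1) → ∀ f : ℕ → G,
      IsColoring D'.pieces f → ∃ g : ℕ → G, IsColoring D.pieces g ∧ ∀ e ∈ B, g e = f e)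
    (ext' : ∀ (G : Type) [Group G], (∀ x : G, x ^ n = 1) → ∀ f : ℕ → G,
      IsColoring D.pieces f → ∃ g : ℕ → G, IsColoring D'.pieces g ∧ ∀ e ∈ B, g e = f e)
    (uniq : ∀ (G : Type) [Group G] (f g : ℕ → G),
      IsColoring D.pieces f → IsColoring D.pieces g → (∀ e ∈ B, f e = g e) →
        ∀ e ∈ edgeEnds D.pieces, f e = g e)
    (uniq' : ∀ (G : Type) [Group G] (f g : ℕ → G),
      IsColoring D'.pieces f → IsColoring D'.pieces g → (∀ e ∈ B, f e = g e) →
        ∀ e ∈ edgeEnds D'.pieces, f e = g e) :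
    Nonempty (BurnsideGroup n D ≃* BurnsideGroup n D') := by
  -- Yoneda: the universal colouring of each diagram is carried to the other one along the boundary
  -- `B`, and induces a homomorphism of Burnside groups in each direction.
  obtain ⟨f, hf, hfB⟩ := ext' _ ModPowers.pow_eq_one _ (D.isColoring_bgen n)
  obtain ⟨φ, hφ⟩ := hf.exists_burnside_hom ModPowers.pow_eq_one
  obtain ⟨g, hg, hgB⟩ := ext _ ModPowers.pow_eq_one _ (D'.isColoring_bgen n)
  obtain ⟨ψ, hψ⟩ := hg.exists_burnside_hom ModPowers.pow_eq_one
  refine ⟨MonoidHom.toMulEquiv ψ φ (BurnsideGroup.hom_ext ?_) (BurnsideGroup.hom_ext ?_)⟩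
  -- Both sides are colourings that agree on `B`, hence everywhere.
  · refine uniq _ ((φ.comp ψ) ∘ D.bgen n) (D.bgen n)
      ((D.isColoring_bgen n).map _) (D.isColoring_bgen n) fun e he => ?_
    simp only [Function.comp_apply, MonoidHom.comp_apply]
    rw [hψ e (sub e he), hgB e he, hφ e (sub' e he), hfB e he]
  · refine uniq' _ ((ψ.comp φ) ∘ D'.bgen n) (D'.bgen n)
      ((D'.isColoring_bgen n).map _) (D'.isColoring_bgen n) fun e he => ?_
    simp only [Function.comp_apply, MonoidHom.comp_apply]
    rw [hφ e (sub' e he), hfB e he, hψ e (sub e he), hgB e he]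

/-- If the colourings of `D` by groups of exponent `n` restrict to colourings of `D'`, and each
colouring of `D'` extends uniquely, then the Burnside groups agree. -/
theorem burnside_mulEquiv_of_colorings {n : ℕ} {D D' : Diagram}
    (sub : ∀ e ∈ edgeEnds D'.pieces, e ∈ edgeEnds D.pieces)
    (res : ∀ (G : Type) [Group G], (∀ x : G, x ^ n = 1) → ∀ f : ℕ → G,
      IsColoring D.pieces f → IsColoring D'.pieces f)
    (ext : ∀ (G : Type) [Group G], (∀ x : G, x ^ n = 1) → ∀ f : ℕ → G,
      IsColoring D'.pieces f → ∃ g : ℕ → G, IsColoring D.pieces g ∧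
        ∀ e ∈ edgeEnds D'.pieces, g e = f e)
    (uniq : ∀ (G : Type) [Group G] (f g : ℕ → G),
      IsColoring D.pieces f → IsColoring D.pieces g → (∀ e ∈ edgeEnds D'.pieces, f e = g e) →
        ∀ e ∈ edgeEnds D.pieces, f e = g e) :
    Nonempty (BurnsideGroup n D ≃* BurnsideGroup n D') :=
  burnside_mulEquiv_of_boundary {e | e ∈ edgeEnds D'.pieces} sub (fun _ he => he) ext
    (fun G _ hG f hf => ⟨f, res G hG f hf, fun _ _ => rfl⟩) uniq (fun _ _ _ _ _ _ h => h)

end Welded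

namespace Welded

/-! ### Invariance under welded moves -/

theorem burnside_mulEquiv_of_same_edges {n : ℕ} {D D' : Diagram}
    (he : ∀ e, e ∈ edgeEnds D.pieces ↔ e ∈ edgeEnds D'.pieces)
    (hc : ∀ (G : Type) [Group G], ∀ f : ℕ → G,
      IsColoring D.pieces f ↔ IsColoring D'.pieces f) :
    Nonempty (BurnsideGroup n D ≃* BurnsideGroup n D') :=
  burnside_mulEquiv_of_colorings (fun e h => (he e).2 h) (fun G _ _ f h => (hc G f).1 h)
    (fun G _ _ f h => ⟨f, (hc G f).2 h, fun _ _ => rfl⟩)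
    (fun _ _ _ _ _ _ h e hD => h e ((he e).1 hD))

/-- Used to give a fresh label to an edge created by a move; such an edge has both ends inside the
pictured part. -/
theorem IsColoring.update {G : Type*} [Group G] {S : Multiset Piece} {f : ℕ → G}
    (h : IsColoring S f) {c : ℕ} (hc : c ∉ edgeEnds S) (x : G) :
    IsColoring S (Function.update f c x) :=
  h.congr fun e he => by rw [Function.update_of_ne]; rintro rfl; exact hc he

theorem mem_edgeEnds_crossing_cons {a b c d e : ℕ} {S : Multiset Piece} :
    e ∈ edgeEnds (.crossing a b c d ::ₘ S) ↔ e = a ∨ e = b ∨ e = c ∨ e = d ∨ e ∈ edgeEnds S := by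
  simp [edgeEnds_cons, Piece.ends]

theorem mem_edgeEnds_joint_cons {a b e : ℕ} {S : Multiset Piece} :
    e ∈ edgeEnds (.joint a b ::ₘ S) ↔ e = a ∨ e = b ∨ e ∈ edgeEnds S := by
  simp [edgeEnds_cons, Piece.ends]

theorem count_edgeEnds_crossing_cons {a b c d e : ℕ} {S : Multiset Piece} :
    (edgeEnds (.crossing a b c d ::ₘ S)).count e = (if e = a then 1 else 0) +
      (if e = b then 1 else 0) + (if e = c then 1 else 0) + (if e = d then 1 else 0) +
      (edgeEnds S).count e := by
  simp only [edgeEnds_cons, Piece.ends, Multiset.insert_eq_cons, Multiset.count_add,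
    Multiset.count_cons, Multiset.count_singleton]
  omega

theorem count_edgeEnds_joint_cons {a b e : ℕ} {S : Multiset Piece} :
    (edgeEnds (.joint a b ::ₘ S)).count e = (if e = a then 1 else 0) +
      (if e = b then 1 else 0) + (edgeEnds S).count e := by
  simp only [edgeEnds_cons, Piece.ends, Multiset.insert_eq_cons, Multiset.count_add,
    Multiset.count_cons, Multiset.count_singleton]
  omega

section Moves

variable {n : ℕ} {D D' : Diagram} {S : Multiset Piece}

theorem burnside_rename (f : ℕ → ℕ) (hf : Function.Injective f)
    (h : D'.pieces = D.pieces.map (Piece.rename f)) :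
    Nonempty (BurnsideGroup n D ≃* BurnsideGroup n D') := by
  have hE : edgeEnds D'.pieces = (edgeEnds D.pieces).map f := by
    rw [h, edgeEnds, edgeEnds, Multiset.bind_map, Multiset.map_bind]
    refine Multiset.bind_congr fun P _ => ?_
    cases P <;> simp [Piece.ends, Piece.rename]
  have h1 : IsColoring D.pieces (D'.bgen n ∘ f) := by
    rw [← isColoring_rename, ← h]; exact D'.isColoring_bgen n
  have h2 : IsColoring D'.pieces (D.bgen n ∘ Function.invFun f) := by
    rw [h, isColoring_rename, Function.comp_assoc, Function.invFun_comp hf, Function.comp_id]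
    exact D.isColoring_bgen n
  obtain ⟨φ, hφ⟩ := h1.exists_burnside_hom ModPowers.pow_eq_one
  obtain ⟨ψ, hψ⟩ := h2.exists_burnside_hom ModPowers.pow_eq_one
  have hinv : ∀ e, Function.invFun f (f e) = e := Function.leftInverse_invFun hf
  refine ⟨MonoidHom.toMulEquiv φ ψ (BurnsideGroup.hom_ext fun e he => ?_)
    (BurnsideGroup.hom_ext fun e he => ?_)⟩
  · have : f e ∈ edgeEnds D'.pieces := hE ▸ Multiset.mem_map_of_mem f he
    simp [hφ e he, hψ _ this, hinv]
  · obtain ⟨e, he', rfl⟩ := Multiset.mem_map.1 (hE ▸ he)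
    simp [hψ _ he, hinv, hφ e he']

theorem burnside_merge {a b : ℕ} (hab : a ≠ b) (h : D.pieces = .joint a b ::ₘ S)
    (h' : D'.pieces = S.map (Piece.rename fun e => if e = b then a else e)) :
    Nonempty (BurnsideGroup n D ≃* BurnsideGroup n D') := by
  have hE : edgeEnds D'.pieces = (edgeEnds S).map (fun e => if e = b then a else e) := by
    rw [h', edgeEnds, edgeEnds, Multiset.bind_map, Multiset.map_bind]
    refine Multiset.bind_congr fun P _ => ?_
    cases P <;> simp [Piece.ends, Piece.rename]
  have hb := h ▸ D.closed b
  rw [mem_edgeEnds_joint_cons, count_edgeEnds_joint_cons] at hb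
  -- Of the two ends of `b`, only one is at the joint, since `a ≠ b`; the other one lies in `S`.
  have hbS : b ∈ edgeEnds S := by
    rw [← Multiset.count_pos]
    simp [hab.symm] at hb
    omega
  have mem : ∀ e, e ∈ edgeEnds D.pieces ↔ e = b ∨ e ∈ edgeEnds D'.pieces := by
    intro e
    rw [h, mem_edgeEnds_joint_cons, hE, Multiset.mem_map]
    constructor
    · rintro (rfl | rfl | he)
      · exact Or.inr ⟨b, hbS, by simp⟩
      · exact Or.inl rfl
      · by_cases heb : e = b
        · exact Or.inl heb
        · exact Or.inr ⟨e, he, by simp [heb]⟩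
    · rintro (rfl | ⟨e', he', rfl⟩)
      · simp
      · split_ifs <;> simp [he']
  have haD' : a ∈ edgeEnds D'.pieces := by
    rw [hE]; exact Multiset.mem_map.2 ⟨b, hbS, by simp⟩
  have hbD' : b ∉ edgeEnds D'.pieces := by
    rw [hE, Multiset.mem_map]
    rintro ⟨e, -, he⟩
    split_ifs at he with h1
    · exact hab he
    · exact h1 he
  refine burnside_mulEquiv_of_colorings (fun e he => (mem e).2 (Or.inr he)) ?_ ?_ ?_
  · intro G _ _ f hf
    rw [h, isColoring_cons] at hf
    rw [h', isColoring_rename]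
    refine hf.2.congr fun e _ => ?_
    have h1 : f a = f b := hf.1
    simp only [Function.comp_apply]
    split_ifs with heb
    · rw [h1, heb]
    · rfl
  · intro G _ _ f hf
    refine ⟨Function.update f b (f a), ?_, fun e he => ?_⟩
    · rw [h, isColoring_cons]
      refine ⟨?_, ?_⟩
      · change Function.update f b (f a) a = Function.update f b (f a) b
        simp [hab]
      · rw [h', isColoring_rename] at hf
        refine hf.congr fun e _ => ?_
        by_cases heb : e = b <;> simp [heb]
    · rw [Function.update_of_ne]; rintro rfl; exact hbD' he
  · intro G _ f g hf hg hfg e he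
    rcases (mem e).1 he with rfl | he
    · rw [h, isColoring_cons] at hf hg
      have h1 : f a = f e := hf.1
      have h2 : g a = g e := hg.1
      rw [← h1, ← h2, hfg a haD']
    · exact hfg e he

/-- The kink edge `c` already has both ends at the crossing, so it occurs nowhere else. The
relations reduce to `y * y⁻¹ * y = y`. -/
theorem burnside_R1 {a b c : ℕ} (h : D.pieces = .crossing c c a b ::ₘ S)
    (h' : D'.pieces = .joint a b ::ₘ S) :
    Nonempty (BurnsideGroup n D ≃* BurnsideGroup n D') := by
  have hc := h ▸ D.closed c
  rw [mem_edgeEnds_crossing_cons, count_edgeEnds_crossing_cons] at hc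
  have hc' := hc (Or.inl rfl)
  have hca : c ≠ a := by rintro rfl; simp at hc'; omega
  have hcb : c ≠ b := by rintro rfl; simp at hc'; omega
  have hcS : c ∉ edgeEnds S := by rw [← Multiset.count_eq_zero]; simp at hc'; omega
  refine burnside_mulEquiv_of_colorings ?_ ?_ ?_ ?_
  · intro e
    rw [h, h', mem_edgeEnds_crossing_cons, mem_edgeEnds_joint_cons]
    tauto
  · intro G _ _ f hf
    rw [h, isColoring_cons] at hf
    rw [h', isColoring_cons]
    refine ⟨?_, hf.2⟩
    obtain ⟨h1, h2⟩ := hf.1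
    change f a = f b
    rw [h2, ← h1]; group
  · intro G _ _ f hf
    rw [h', isColoring_cons] at hf
    have hab : f a = f b := hf.1
    refine ⟨Function.update f c (f a), ?_, fun e he => ?_⟩
    · rw [h, isColoring_cons]
      refine ⟨?_, hf.2.update hcS _⟩
      simp [Piece.IsColored, hca.symm, hcb.symm, hab]
    · rw [Function.update_of_ne]
      rintro rfl
      rw [h', mem_edgeEnds_joint_cons] at he
      tauto
  · intro G _ f g hf hg hfg e he
    rw [h, isColoring_cons] at hf hg
    simp only [h', mem_edgeEnds_joint_cons] at hfg
    rw [h, mem_edgeEnds_crossing_cons] at he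
    by_cases hec : e = c
    · rw [hec, hf.1.1, hg.1.1]
      exact hfg b (by tauto)
    · exact hfg e (by tauto)

theorem burnside_R1' {a b c : ℕ} (h : D.pieces = .crossing a c c b ::ₘ S)
    (h' : D'.pieces = .joint a b ::ₘ S) :
    Nonempty (BurnsideGroup n D ≃* BurnsideGroup n D') := by
  have hc := h ▸ D.closed c
  rw [mem_edgeEnds_crossing_cons, count_edgeEnds_crossing_cons] at hc
  have hc' := hc (Or.inr (Or.inl rfl))
  have hca : c ≠ a := by rintro rfl; simp at hc'; omega
  have hcb : c ≠ b := by rintro rfl; simp at hc'; omega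
  have hcS : c ∉ edgeEnds S := by rw [← Multiset.count_eq_zero]; simp at hc'; omega
  refine burnside_mulEquiv_of_colorings ?_ ?_ ?_ ?_
  · intro e
    rw [h, h', mem_edgeEnds_crossing_cons, mem_edgeEnds_joint_cons]
    tauto
  · intro G _ _ f hf
    rw [h, isColoring_cons] at hf
    rw [h', isColoring_cons]
    refine ⟨?_, hf.2⟩
    obtain ⟨h1, h2⟩ := hf.1
    change f a = f b
    rw [← h1]
    rw [mul_assoc, left_eq_mul, inv_mul_eq_one] at h2
    exact h2
  · intro G _ _ f hf
    rw [h', isColoring_cons] at hf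
    have hab : f a = f b := hf.1
    refine ⟨Function.update f c (f a), ?_, fun e he => ?_⟩
    · rw [h, isColoring_cons]
      refine ⟨?_, hf.2.update hcS _⟩
      simp [Piece.IsColored, hca.symm, hcb.symm, hab]
    · rw [Function.update_of_ne]
      rintro rfl
      rw [h', mem_edgeEnds_joint_cons] at he
      tauto
  · intro G _ f g hf hg hfg e he
    rw [h, isColoring_cons] at hf hg
    simp only [h', mem_edgeEnds_joint_cons] at hfg
    rw [h, mem_edgeEnds_crossing_cons] at he
    by_cases hec : e = c
    · rw [hec, hf.1.1, hg.1.1]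
      exact hfg b (by tauto)
    · exact hfg e (by tauto)

/-- Passing twice under `y` does nothing, because `x ↦ y * x⁻¹ * y` is an involution. -/
theorem burnside_R2 {a b c d k l : ℕ}
    (h : D.pieces = .crossing c k l a ::ₘ .crossing l k d b ::ₘ S)
    (h' : D'.pieces = .joint a b ::ₘ .joint c d ::ₘ S) :
    Nonempty (BurnsideGroup n D ≃* BurnsideGroup n D') := by
  have mem : ∀ e, e ∈ edgeEnds D.pieces ↔ e = k ∨ e = l ∨ e ∈ edgeEnds D'.pieces := by
    intro e
    simp only [h, h', mem_edgeEnds_crossing_cons, mem_edgeEnds_joint_cons]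
    tauto
  have hk := h ▸ D.closed k
  have hl := h ▸ D.closed l
  simp only [mem_edgeEnds_crossing_cons, count_edgeEnds_crossing_cons] at hk hl
  have hk' := hk (by tauto)
  have hl' := hl (by tauto)
  simp only [if_true] at hk' hl'
  have hkl : k ≠ l := by rintro rfl; simp at hk'; omega
  have hka : k ≠ a := by rintro rfl; simp at hk'; omega
  have hkb : k ≠ b := by rintro rfl; simp at hk'; omega
  have hkc : k ≠ c := by rintro rfl; simp at hk'; omega
  have hkd : k ≠ d := by rintro rfl; simp at hk'; omega
  have hla : l ≠ a := by rintro rfl; simp at hl'; omega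
  have hlb : l ≠ b := by rintro rfl; simp at hl'; omega
  have hlc : l ≠ c := by rintro rfl; simp at hl'; omega
  have hld : l ≠ d := by rintro rfl; simp at hl'; omega
  have hkS : k ∉ edgeEnds S := by rw [← Multiset.count_eq_zero]; omega
  have hlS : l ∉ edgeEnds S := by rw [← Multiset.count_eq_zero]; omega
  refine burnside_mulEquiv_of_colorings ?_ ?_ ?_ ?_
  · exact fun e he => (mem e).2 (Or.inr (Or.inr he))
  · intro G _ _ f hf
    simp only [h, isColoring_cons] at hf
    simp only [h', isColoring_cons]
    obtain ⟨⟨h1, h2⟩, ⟨h3, h4⟩, h5⟩ := hf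
    refine ⟨h1.symm.trans h3, ?_, h5⟩
    change f c = f d
    rw [h4, h2]; group
  · intro G _ _ f hf
    simp only [h', isColoring_cons] at hf
    obtain ⟨h1, h2, h3⟩ := hf
    have h1 : f a = f b := h1
    have h2 : f c = f d := h2
    refine ⟨Function.update (Function.update f k (f a)) l (f a * (f c)⁻¹ * f a), ?_,
      fun e he => ?_⟩
    · simp only [h, isColoring_cons]
      refine ⟨?_, ?_, (h3.update hkS _).update hlS _⟩
      · simp [Piece.IsColored, Function.update_of_ne, hkl, hka.symm, hkc.symm, hla.symm, hlc.symm]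
      · simp [Piece.IsColored, Function.update_of_ne, hkl, hkb.symm, hkd.symm, hlb.symm, hld.symm,
          h1, h2, mul_assoc]
    · simp only [h', mem_edgeEnds_joint_cons] at he
      rw [Function.update_of_ne, Function.update_of_ne]
      · rintro rfl; simp_all
      · rintro rfl; simp_all
  · intro G _ f g hf hg hfg e he
    simp only [h, isColoring_cons] at hf hg
    have hfga : f a = g a := hfg a (by simp [h', mem_edgeEnds_joint_cons])
    have hfgc : f c = g c := hfg c (by simp [h', mem_edgeEnds_joint_cons])
    have hfgk : f k = g k := by rw [hf.1.1, hg.1.1, hfga]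
    rcases (mem e).1 he with rfl | rfl | he
    · exact hfgk
    · rw [hf.1.2, hg.1.2, hfgk, hfgc]
    · exact hfg e he

/-- The inner edges `m` and `b` bear different labels before and after the move, so the comparison
runs over the other edges only. Both pictures give `b₂ = t * m₁⁻¹ * b₁ * m₁⁻¹ * t` in terms of the
labels, which is self-distributivity. The relations enter as equivalences `hD`, `hD'`, so that both
reflections of the move are covered. -/
theorem burnside_R3_aux {t₁ t t₂ m₁ m m₂ b₁ b b₂ : ℕ}
    (hE : ∀ e, e ∈ edgeEnds D.pieces ↔ e = m ∨ e = b ∨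
      e ∈ [t₁, t, t₂, m₁, m₂, b₁, b₂] ∨ e ∈ edgeEnds S)
    (hE' : ∀ e, e ∈ edgeEnds D'.pieces ↔ e = m ∨ e = b ∨
      e ∈ [t₁, t, t₂, m₁, m₂, b₁, b₂] ∨ e ∈ edgeEnds S)
    (hmb : m ≠ b) (hm : m ∉ [t₁, t, t₂, m₁, m₂, b₁, b₂]) (hb : b ∉ [t₁, t, t₂, m₁, m₂, b₁, b₂])
    (hmS : m ∉ edgeEnds S) (hbS : b ∉ edgeEnds S)
    (hD : ∀ (G : Type) [Group G] (f : ℕ → G), IsColoring D.pieces f ↔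
      (f t = f t₁ ∧ f m = f t * (f m₁)⁻¹ * f t) ∧ (f t₂ = f t ∧ f b = f t₂ * (f b₁)⁻¹ * f t₂) ∧
      (f m₂ = f m ∧ f b₂ = f m₂ * (f b)⁻¹ * f m₂) ∧ IsColoring S f)
    (hD' : ∀ (G : Type) [Group G] (f : ℕ → G), IsColoring D'.pieces f ↔
      (f m = f m₁ ∧ f b = f m * (f b₁)⁻¹ * f m) ∧ (f t = f t₁ ∧ f b₂ = f t * (f b)⁻¹ * f t) ∧
      (f t₂ = f t ∧ f m₂ = f t₂ * (f m)⁻¹ * f t₂) ∧ IsColoring S f) :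
    Nonempty (BurnsideGroup n D ≃* BurnsideGroup n D') := by
  have key : ∀ (G : Type) [Group G] (f : ℕ → G) (x y : G),
      ∀ e ∈ {e | e ∈ [t₁, t, t₂, m₁, m₂, b₁, b₂] ∨ e ∈ edgeEnds S},
        Function.update (Function.update f m x) b y e = f e := by
    intro G _ f x y e he
    rw [Function.update_of_ne, Function.update_of_ne]
    · rintro rfl; exact he.elim hm hmS
    · rintro rfl; exact he.elim hb hbS
  have keys : ∀ (G : Type) [Group G] (f g : ℕ → G),
      (∀ e ∈ {e | e ∈ [t₁, t, t₂, m₁, m₂, b₁, b₂] ∨ e ∈ edgeEnds S}, f e = g e) →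
      f t₁ = g t₁ ∧ f t = g t ∧ f t₂ = g t₂ ∧ f m₁ = g m₁ ∧ f m₂ = g m₂ ∧ f b₁ = g b₁ ∧
        f b₂ = g b₂ := by
    intro G _ f g h
    refine ⟨h _ ?_, h _ ?_, h _ ?_, h _ ?_, h _ ?_, h _ ?_, h _ ?_⟩ <;> exact Or.inl (by simp)
  refine burnside_mulEquiv_of_boundary
    {e | e ∈ [t₁, t, t₂, m₁, m₂, b₁, b₂] ∨ e ∈ edgeEnds S}
    (fun e he => (hE e).2 (Or.inr (Or.inr he))) (fun e he => (hE' e).2 (Or.inr (Or.inr he)))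
    ?_ ?_ ?_ ?_
  · intro G _ _ f hf
    obtain ⟨⟨h1, h2⟩, ⟨h3, h4⟩, ⟨h5, h6⟩, h7⟩ := (hD' G f).1 hf
    refine ⟨_, (hD G _).2 ?_, key G f (f t * (f m₁)⁻¹ * f t) (f t₂ * (f b₁)⁻¹ * f t₂)⟩
    obtain ⟨k1, k2, k3, k4, k5, k6, k7⟩ :=
      keys G _ _ (key G f (f t * (f m₁)⁻¹ * f t) (f t₂ * (f b₁)⁻¹ * f t₂))
    rw [k1, k2, k3, k4, k5, k6, k7]
    simp only [Function.update_self, Function.update_of_ne hmb]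
    refine ⟨⟨h3, trivial⟩, ⟨h5, trivial⟩, ⟨by rw [h6, h5, h1], ?_⟩, (h7.update hmS _).update hbS _⟩
    rw [h4, h6, h5, h2, h1]; group
  · intro G _ _ f hf
    obtain ⟨⟨h1, h2⟩, ⟨h3, h4⟩, ⟨h5, h6⟩, h7⟩ := (hD G f).1 hf
    refine ⟨_, (hD' G _).2 ?_, key G f (f m₁) (f m₁ * (f b₁)⁻¹ * f m₁)⟩
    obtain ⟨k1, k2, k3, k4, k5, k6, k7⟩ :=
      keys G _ _ (key G f (f m₁) (f m₁ * (f b₁)⁻¹ * f m₁))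
    rw [k1, k2, k3, k4, k5, k6, k7]
    simp only [Function.update_self, Function.update_of_ne hmb]
    refine ⟨⟨trivial, trivial⟩, ⟨h1, ?_⟩, ⟨h3, by rw [h5, h2, h3]⟩, (h7.update hmS _).update hbS _⟩
    rw [h6, h5, h2, h4, h3]; group
  · intro G _ f g hf hg hfg e he
    obtain ⟨k1, k2, k3, k4, k5, k6, k7⟩ := keys G _ _ hfg
    rw [hD] at hf hg
    rcases (hE e).1 he with rfl | rfl | he
    · rw [hf.1.2, hg.1.2, k2, k4]
    · rw [hf.2.1.2, hg.2.1.2, k3, k6]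
    · exact hfg e he
  · intro G _ f g hf hg hfg e he
    obtain ⟨k1, k2, k3, k4, k5, k6, k7⟩ := keys G _ _ hfg
    rw [hD'] at hf hg
    rcases (hE' e).1 he with rfl | rfl | he
    · rw [hf.1.1, hg.1.1, k4]
    · rw [hf.1.2, hg.1.2, hf.1.1, hg.1.1, k4, k6]
    · exact hfg e he

theorem burnside_R3 {t₁ t t₂ m₁ m m₂ b₁ b b₂ : ℕ}
    (h : D.pieces = .crossing m₁ t m t₁ ::ₘ .crossing b₁ t₂ b t ::ₘ .crossing b m₂ b₂ m ::ₘ S)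
    (h' : D'.pieces = .crossing b₁ m b m₁ ::ₘ .crossing b t b₂ t₁ ::ₘ .crossing m t₂ m₂ t ::ₘ S) :
    Nonempty (BurnsideGroup n D ≃* BurnsideGroup n D') := by
  have hm := h ▸ D.closed m
  have hb := h ▸ D.closed b
  -- The edges `m` and `b` have both ends at the three crossings shown; counting ends then separates
  -- them from each other, from the other named edges and from `S`.
  simp only [mem_edgeEnds_crossing_cons, count_edgeEnds_crossing_cons, true_or, or_true,
    forall_const, if_true] at hm hb
  refine burnside_R3_aux (S := S) (t₁ := t₁) (t := t) (t₂ := t₂) (m₁ := m₁) (m := m) (m₂ := m₂)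
    (b₁ := b₁) (b := b) (b₂ := b₂) (fun e => ?_) (fun e => ?_) ?_ ?_ ?_ ?_ ?_ (fun G _ f => ?_)
    (fun G _ f => ?_)
  · simp only [h, mem_edgeEnds_crossing_cons, List.mem_cons, List.not_mem_nil]
    tauto
  · simp only [h', mem_edgeEnds_crossing_cons, List.mem_cons, List.not_mem_nil]
    tauto
  · rintro rfl
    simp only [if_true] at hm
    omega
  · simp only [List.mem_cons, List.not_mem_nil, or_false, not_or]
    refine ⟨?_, ?_, ?_, ?_, ?_, ?_, ?_⟩ <;> rintro rfl <;> simp only [if_true] at hm <;> omega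
  · simp only [List.mem_cons, List.not_mem_nil, or_false, not_or]
    refine ⟨?_, ?_, ?_, ?_, ?_, ?_, ?_⟩ <;> rintro rfl <;> simp only [if_true] at hb <;> omega
  · rw [← Multiset.count_eq_zero]; omega
  · rw [← Multiset.count_eq_zero]; omega
  · simp only [h, isColoring_cons, Piece.IsColored]
  · simp only [h', isColoring_cons, Piece.IsColored]

/-- Colourings do not see the sign of a crossing; this reduces the reflected third move to the same
algebra. -/
theorem Piece.isColored_crossing_swap {G : Type*} [Group G] {f : ℕ → G} {x y z y' : ℕ} :
    (Piece.crossing x y z y').IsColored f ↔ (Piece.crossing x y' z y).IsColored f := by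
  constructor <;> rintro ⟨h1, h2⟩ <;> exact ⟨h1.symm, by rw [h2, h1]⟩

theorem burnside_R3' {t₁ t t₂ m₁ m m₂ b₁ b b₂ : ℕ}
    (h : D.pieces = .crossing m₁ t₁ m t ::ₘ .crossing b₁ t b t₂ ::ₘ .crossing b m b₂ m₂ ::ₘ S)
    (h' : D'.pieces = .crossing b₁ m₁ b m ::ₘ .crossing b t₁ b₂ t ::ₘ .crossing m t m₂ t₂ ::ₘ S) :
    Nonempty (BurnsideGroup n D ≃* BurnsideGroup n D') := by
  have hm := h ▸ D.closed m
  have hb := h ▸ D.closed b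
  simp only [mem_edgeEnds_crossing_cons, count_edgeEnds_crossing_cons, true_or, or_true,
    forall_const, if_true] at hm hb
  refine burnside_R3_aux (S := S) (t₁ := t₁) (t := t) (t₂ := t₂) (m₁ := m₁) (m := m) (m₂ := m₂)
    (b₁ := b₁) (b := b) (b₂ := b₂) (fun e => ?_) (fun e => ?_) ?_ ?_ ?_ ?_ ?_ (fun G _ f => ?_)
    (fun G _ f => ?_)
  · simp only [h, mem_edgeEnds_crossing_cons, List.mem_cons, List.not_mem_nil]
    tauto
  · simp only [h', mem_edgeEnds_crossing_cons, List.mem_cons, List.not_mem_nil]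
    tauto
  · rintro rfl
    simp only [if_true] at hm
    omega
  · simp only [List.mem_cons, List.not_mem_nil, or_false, not_or]
    refine ⟨?_, ?_, ?_, ?_, ?_, ?_, ?_⟩ <;> rintro rfl <;> simp only [if_true] at hm <;> omega
  · simp only [List.mem_cons, List.not_mem_nil, or_false, not_or]
    refine ⟨?_, ?_, ?_, ?_, ?_, ?_, ?_⟩ <;> rintro rfl <;> simp only [if_true] at hb <;> omega
  · rw [← Multiset.count_eq_zero]; omega
  · rw [← Multiset.count_eq_zero]; omega
  · simp only [h, isColoring_cons]
    rw [Piece.isColored_crossing_swap, Piece.isColored_crossing_swap (x := b₁),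
      Piece.isColored_crossing_swap (x := b)]
    simp only [Piece.IsColored]
  · simp only [h', isColoring_cons]
    rw [Piece.isColored_crossing_swap, Piece.isColored_crossing_swap (x := b),
      Piece.isColored_crossing_swap (x := m)]
    simp only [Piece.IsColored]

/-- The Burnside groups are invariant under welded moves. -/
theorem WeldedMove.burnside (h : WeldedMove D.pieces D'.pieces) :
    Nonempty (BurnsideGroup n D ≃* BurnsideGroup n D') := by
  generalize hS : D.pieces = T at h
  generalize hS' : D'.pieces = T' at h
  cases h with
  | rename f hf S => exact burnside_rename f hf (hS ▸ hS')
  | rotate a b c d S =>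
    refine burnside_mulEquiv_of_same_edges (fun e => ?_) fun G _ f => ?_
    · simp only [hS, hS', mem_edgeEnds_crossing_cons]
      tauto
    · simp only [hS, hS', isColoring_cons, Piece.IsColored]
      refine and_congr_left fun _ => ⟨?_, ?_⟩
      · rintro ⟨h1, h2⟩
        exact ⟨h1.symm, by rw [← h1, h2]; group⟩
      · rintro ⟨h1, h2⟩
        exact ⟨h1.symm, by rw [← h1, h2]; group⟩
  | flip a b S =>
    refine burnside_mulEquiv_of_same_edges (fun e => ?_) fun G _ f => ?_
    · simp only [hS, hS', mem_edgeEnds_joint_cons]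
      tauto
    · simp only [hS, hS', isColoring_cons, Piece.IsColored, eq_comm]
  | merge a b hab S => exact burnside_merge hab hS hS'
  | R1 a b c S => exact burnside_R1 hS hS'
  | R1' a b c S => exact burnside_R1' hS hS'
  | R2 a b c d k l S => exact burnside_R2 hS hS'
  | R3 t₁ t t₂ m₁ m m₂ b₁ b b₂ S => exact burnside_R3 hS hS'
  | R3' t₁ t t₂ m₁ m m₂ b₁ b b₂ S => exact burnside_R3' hS hS'
  | OC a e b c c' d d' S =>
    refine burnside_mulEquiv_of_same_edges (fun x => ?_) fun G _ f => ?_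
    · simp only [hS, hS', mem_edgeEnds_crossing_cons]
      tauto
    · simp only [hS, hS', isColoring_cons, Piece.IsColored]
      -- The edges `a, e, b` of the overpassing strand share one label, so the order of the two
      -- underpasses is irrelevant.
      constructor
      · rintro ⟨⟨h1, h2⟩, ⟨h3, h4⟩, h5⟩
        exact ⟨⟨h1, by rw [h4, h1]⟩, ⟨h3, by rw [h2, h1]⟩, h5⟩
      · rintro ⟨⟨h1, h2⟩, ⟨h3, h4⟩, h5⟩
        exact ⟨⟨h1, by rw [h4, h1]⟩, ⟨h3, by rw [h2, h1]⟩, h5⟩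

end Moves

end Welded

namespace Welded

/-! ### Invariance under `n`-moves -/

/-- The edges strictly inside a row of `n` half twists. -/
def twistInner (n : ℕ) (u l : ℕ → ℕ) : Multiset ℕ :=
  (Multiset.range (n - 1)).map (fun i => u (i + 1)) +
    (Multiset.range (n - 1)).map (fun i => l (i + 1))

theorem edgeEnds_twist {n : ℕ} (hn : 0 < n) (u l : ℕ → ℕ) :
    edgeEnds (twist n u l) = twistInner n u l + twistInner n u l + {u 0, u n, l 0, l n} := by
  obtain ⟨k, rfl⟩ : ∃ k, n = k + 1 := ⟨n - 1, by omega⟩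
  clear hn
  induction k with
  | zero =>
    ext e
    simp only [twist, edgeEnds, twistInner, Piece.ends, Multiset.range_succ, Multiset.range_zero,
      Multiset.cons_zero, Multiset.map_singleton, Multiset.singleton_bind,
      Multiset.insert_eq_cons, Nat.add_sub_cancel, Multiset.map_zero, Multiset.count_add,
      Multiset.count_cons, Multiset.count_singleton, Multiset.count_zero]
    omega
  | succ k ih =>
    have h1 : twist (k + 1 + 1) u l = Piece.crossing (l (k + 1)) (l (k + 1 + 1)) (u (k + 1 + 1))
        (u (k + 1)) ::ₘ twist (k + 1) u l := by
      simp [twist]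
    rw [h1, edgeEnds_cons, ih]
    ext e
    simp only [twistInner, Piece.ends, Nat.add_sub_cancel, Multiset.range_succ k,
      Multiset.map_cons, Multiset.insert_eq_cons, Multiset.count_add,
      Multiset.count_cons, Multiset.count_singleton]
    omega

/-- A half twist sends the labels `(a, b)` (upper, lower) to `(a * b⁻¹ * a, a)`, that is, to `(x *
a, x * b)` with `x = a * b⁻¹`. This `x` is unchanged by the step, since `(x * a) * (x * b)⁻¹ = x`,
so `i` half twists multiply both labels by `x ^ i`. -/
theorem isColoring_twist {n : ℕ} {u l : ℕ → ℕ} {G : Type*} [Group G] {f : ℕ → G} :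
    IsColoring (twist n u l) f ↔ ∀ i < n, f (u i) = (f (u 0) * (f (l 0))⁻¹) ^ i * f (u 0) ∧
      f (l i) = (f (u 0) * (f (l 0))⁻¹) ^ i * f (l 0) ∧
      f (u (i + 1)) = (f (u 0) * (f (l 0))⁻¹) ^ (i + 1) * f (u 0) ∧
      f (l (i + 1)) = (f (u 0) * (f (l 0))⁻¹) ^ (i + 1) * f (l 0) := by
  have hrel : ∀ (x a b : G) (i : ℕ), x = a * b⁻¹ →
      x ^ i * a * (x ^ i * b)⁻¹ * (x ^ i * a) = x ^ (i + 1) * a ∧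
      x ^ (i + 1) * b = x ^ i * a := by
    rintro x a b i hx
    have ha : a = x * b := by rw [hx]; group
    constructor
    · rw [ha]; group
    · rw [ha, pow_succ, mul_assoc]
  simp only [IsColoring, twist, Multiset.mem_map, Multiset.mem_range, forall_exists_index, and_imp,
    forall_apply_eq_imp_iff₂, Piece.IsColored]
  constructor
  · intro h i hi
    have key : ∀ j ≤ n, f (u j) = (f (u 0) * (f (l 0))⁻¹) ^ j * f (u 0) ∧
        f (l j) = (f (u 0) * (f (l 0))⁻¹) ^ j * f (l 0) := by
      intro j hj
      induction j with
      | zero => simp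
      | succ j ih =>
        obtain ⟨h1, h2⟩ := ih (by omega)
        obtain ⟨h3, h4⟩ := h j (by omega)
        obtain ⟨h5, h6⟩ := hrel _ (f (u 0)) (f (l 0)) j rfl
        rw [h4, h3, h1, h2, h5, h6]
        exact ⟨rfl, rfl⟩
    exact ⟨(key i hi.le).1, (key i hi.le).2, key (i + 1) hi⟩
  · intro h i hi
    obtain ⟨h1, h2, h3, h4⟩ := h i hi
    obtain ⟨h5, h6⟩ := hrel _ (f (u 0)) (f (l 0)) i rfl
    rw [h1, h2, h3, h4, h6, h5]
    exact ⟨rfl, rfl⟩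

/-- The Burnside groups are invariant under `n`-moves. -/
theorem NMove.burnside {n : ℕ} {D D' : Diagram} (h : NMove n D.pieces D'.pieces) :
    Nonempty (BurnsideGroup n D ≃* BurnsideGroup n D') := by
  generalize hS : D.pieces = T at h
  generalize hS' : D'.pieces = T' at h
  obtain ⟨hn, u, l, S⟩ := h
  have hE : edgeEnds D.pieces = twistInner n u l + twistInner n u l + {u 0, u n, l 0, l n} +
      edgeEnds S := by rw [hS, edgeEnds_add, edgeEnds_twist hn]
  have hE' : edgeEnds D'.pieces = {u 0, u n, l 0, l n} + edgeEnds S := by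
    rw [hS', edgeEnds_cons, edgeEnds_cons]
    ext e
    simp only [Piece.ends, Multiset.insert_eq_cons, Multiset.count_add,
      Multiset.count_cons, Multiset.count_singleton]
    omega
  have mem : ∀ e, e ∈ edgeEnds D.pieces ↔ e ∈ twistInner n u l ∨ e ∈ edgeEnds D'.pieces := by
    intro e
    rw [hE, hE']
    simp only [Multiset.mem_add]
    tauto
  -- An inner edge has two ends inside the row for each of its occurrences in `twistInner`; as it
  -- has two ends in all, it occurs once there and not at all in `D'`.
  have hcount : ∀ e ∈ twistInner n u l, (twistInner n u l).count e = 1 ∧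
      e ∉ edgeEnds D'.pieces := by
    intro e he
    have h1 := D.closed e ((mem e).2 (Or.inl he))
    have h2 := Multiset.count_pos.2 he
    rw [← Multiset.count_eq_zero]
    rw [hE, add_assoc, ← hE', Multiset.count_add, Multiset.count_add] at h1
    omega
  have hnodup : (twistInner n u l).Nodup :=
    Multiset.nodup_iff_count_eq_one.2 fun e he => (hcount e he).1
  have hnd := Multiset.nodup_add.1 hnodup
  have hu : ∀ i j, i < n - 1 → j < n - 1 → u (i + 1) = u (j + 1) → i = j := fun i j hi hj hij =>
    Multiset.inj_on_of_nodup_map hnd.1 i (Multiset.mem_range.2 hi) j (Multiset.mem_range.2 hj) hij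
  have hl : ∀ i j, i < n - 1 → j < n - 1 → l (i + 1) = l (j + 1) → i = j := fun i j hi hj hij =>
    Multiset.inj_on_of_nodup_map hnd.2.1 i (Multiset.mem_range.2 hi) j (Multiset.mem_range.2 hj) hij
  have hul : ∀ i j, i < n - 1 → j < n - 1 → u (i + 1) ≠ l (j + 1) := fun i j hi hj hij =>
    Multiset.disjoint_left.1 hnd.2.2 (Multiset.mem_map.2 ⟨i, Multiset.mem_range.2 hi, rfl⟩)
      (Multiset.mem_map.2 ⟨j, Multiset.mem_range.2 hj, hij.symm⟩)
  have memI : ∀ e, e ∈ twistInner n u l ↔ (∃ i < n - 1, u (i + 1) = e) ∨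
      ∃ i < n - 1, l (i + 1) = e := by
    simp [twistInner]
  have hu0 : u 0 ∈ edgeEnds D'.pieces := by rw [hE']; simp
  have hl0 : l 0 ∈ edgeEnds D'.pieces := by rw [hE']; simp
  have hun : u n ∈ edgeEnds D'.pieces := by rw [hE']; simp
  have hln : l n ∈ edgeEnds D'.pieces := by rw [hE']; simp
  refine burnside_mulEquiv_of_colorings (fun e he => (mem e).2 (Or.inr he)) ?_ ?_ ?_
  · intro G _ hG f hf
    rw [hS, isColoring_add, isColoring_twist] at hf
    obtain ⟨-, -, h3, h4⟩ := hf.1 (n - 1) (by omega)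
    -- This is where exponent `n` enters: the last half twist ends with the factor `x ^ n = 1`.
    rw [Nat.sub_add_cancel hn, hG, one_mul] at h3 h4
    rw [hS', isColoring_cons, isColoring_cons]
    exact ⟨h3.symm, h4.symm, hf.2⟩
  · intro G _ hG f hf
    rw [hS', isColoring_cons, isColoring_cons] at hf
    obtain ⟨h1, h2, h3⟩ := hf
    have h1 : f (u 0) = f (u n) := h1
    have h2 : f (l 0) = f (l n) := h2
    classical
    let x := f (u 0) * (f (l 0))⁻¹
    -- The forced labels on the inner edges and the old ones elsewhere. The chosen index is the
    -- right one because the inner edges are pairwise distinct.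
    let g : ℕ → G := fun e =>
      if hi : ∃ i < n - 1, u (i + 1) = e then x ^ (hi.choose + 1) * f (u 0)
      else if hi : ∃ i < n - 1, l (i + 1) = e then x ^ (hi.choose + 1) * f (l 0)
      else f e
    have gu : ∀ i < n - 1, g (u (i + 1)) = x ^ (i + 1) * f (u 0) := by
      intro i hi
      have h : ∃ j < n - 1, u (j + 1) = u (i + 1) := ⟨i, hi, rfl⟩
      simp only [g, dif_pos h]
      rw [hu _ _ h.choose_spec.1 hi h.choose_spec.2]
    have gl : ∀ i < n - 1, g (l (i + 1)) = x ^ (i + 1) * f (l 0) := by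
      intro i hi
      have h : ∃ j < n - 1, l (j + 1) = l (i + 1) := ⟨i, hi, rfl⟩
      have h' : ¬ ∃ j < n - 1, u (j + 1) = l (i + 1) := by
        rintro ⟨j, hj, hji⟩; exact hul j i hj hi hji
      simp only [g, dif_pos h, dif_neg h']
      rw [hl _ _ h.choose_spec.1 hi h.choose_spec.2]
    have ge : ∀ e ∈ edgeEnds D'.pieces, g e = f e := by
      intro e he
      have : e ∉ twistInner n u l := fun hi => (hcount e hi).2 he
      rw [memI, not_or] at this
      simp only [g, dif_neg this.1, dif_neg this.2]
    have gu' : ∀ i ≤ n, g (u i) = x ^ i * f (u 0) := by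
      intro i hi
      rcases Nat.eq_zero_or_pos i with rfl | hi0
      · simp [ge _ hu0]
      rcases hi.eq_or_lt with rfl | hi
      -- At the far end of the row the label is that of `u n`, and `x ^ n = 1` makes it agree with
      -- the joint.
      · rw [hG, one_mul, ge _ hun, h1]
      · obtain ⟨j, rfl⟩ : ∃ j, i = j + 1 := ⟨i - 1, by omega⟩
        exact gu j (by omega)
    have gl' : ∀ i ≤ n, g (l i) = x ^ i * f (l 0) := by
      intro i hi
      rcases Nat.eq_zero_or_pos i with rfl | hi0
      · simp [ge _ hl0]
      rcases hi.eq_or_lt with rfl | hi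
      · rw [hG, one_mul, ge _ hln, h2]
      · obtain ⟨j, rfl⟩ : ∃ j, i = j + 1 := ⟨i - 1, by omega⟩
        exact gl j (by omega)
    refine ⟨g, ?_, ge⟩
    rw [hS, isColoring_add, isColoring_twist]
    refine ⟨fun i hi => ?_, h3.congr fun e he => (ge e ?_).symm⟩
    · rw [ge _ hu0, ge _ hl0]
      exact ⟨gu' i hi.le, gl' i hi.le, gu' _ hi, gl' _ hi⟩
    · rw [hE']
      exact Multiset.mem_add.2 (Or.inr he)
  · intro G _ f g hf hg hfg e he
    rw [hS, isColoring_add, isColoring_twist] at hf hg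
    rcases (mem e).1 he with he | he
    · have h0 := hfg _ hu0
      have h1 := hfg _ hl0
      rcases (memI e).1 he with ⟨i, hi, rfl⟩ | ⟨i, hi, rfl⟩
      · rw [(hf.1 i (by omega)).2.2.1, (hg.1 i (by omega)).2.2.1, h0, h1]
      · rw [(hf.1 i (by omega)).2.2.2, (hg.1 i (by omega)).2.2.2, h0, h1]
    · exact hfg e he

theorem NMoveEquiv.burnside {n : ℕ} {D D' : Diagram} (h : NMoveEquiv n D D') :
    Nonempty (BurnsideGroup n D ≃* BurnsideGroup n D') := by
  induction h with
  | rel D D' h => exact h.elim WeldedMove.burnside NMove.burnside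
  | refl D => exact ⟨MulEquiv.refl _⟩
  | symm D D' _ ih => exact ih.map MulEquiv.symm
  | trans D D' D'' _ _ ih ih' => exact ih.map2 MulEquiv.trans ih'

theorem WeldedEquiv.coreGroup {D D' : Diagram} (h : WeldedEquiv D D') :
    Nonempty (CoreGroup D ≃* CoreGroup D') := by
  -- Every group satisfies `x ^ 0 = 1`, so invariance of the core group is the case `n = 0`.
  have : Nonempty (BurnsideGroup 0 D ≃* BurnsideGroup 0 D') := by
    induction h with
    | rel D D' h => exact h.burnside
    | refl D => exact ⟨MulEquiv.refl _⟩
    | symm D D' _ ih => exact ih.map MulEquiv.symm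
    | trans D D' D'' _ _ ih ih' => exact ih.map2 MulEquiv.trans ih'
  obtain ⟨e⟩ := this
  obtain ⟨e₁⟩ := ModPowers.nonempty_zero_mulEquiv (G := CoreGroup D)
  obtain ⟨e₂⟩ := ModPowers.nonempty_zero_mulEquiv (G := CoreGroup D')
  exact ⟨(e₁.symm.trans e).trans e₂⟩

/-! ### Counting homomorphisms -/

/-- Homomorphisms from a presented group. -/
def presentedGroupHomEquiv {α : Type*} (R : Set (FreeGroup α)) (H : Type*) [Group H] :
    (PresentedGroup R →* H) ≃ {f : α → H // ∀ r ∈ R, FreeGroup.lift f r = 1} where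
  toFun φ := ⟨fun a => φ (PresentedGroup.of a), fun r hr => by
    have h : FreeGroup.lift (fun a => φ (PresentedGroup.of a)) = φ.comp (PresentedGroup.mk R) := by
      ext a; simp [PresentedGroup.of]
    rw [h, MonoidHom.comp_apply, PresentedGroup.one_of_mem hr, map_one]⟩
  invFun f := PresentedGroup.toGroup f.2
  left_inv φ := PresentedGroup.ext fun a => PresentedGroup.toGroup.of _
  right_inv f := Subtype.ext <| funext fun a => PresentedGroup.toGroup.of f.2

theorem unlink_edge (k : ℕ) (e : ℕ) : e ∈ edgeEnds (unlink k).pieces ↔ e < k := by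
  rw [mem_edgeEnds]
  simp [unlink, Piece.ends]

/-- The only relators are `e * e⁻¹`, so any labelling of the `k` circles defines a homomorphism. -/
theorem card_coreGroup_unlink_hom (k : ℕ) (H : Type*) [Group H] :
    Nat.card (CoreGroup (unlink k) →* H) = Nat.card H ^ k := by
  have hP : ∀ P ∈ (unlink k).pieces, ∃ i, P = .joint i i := by
    intro P hP
    have hP : P ∈ (Multiset.range k).map fun i => Piece.joint i i := hP
    obtain ⟨i, -, rfl⟩ := Multiset.mem_map.1 hP
    exact ⟨i, rfl⟩
  have h : ∀ f : (unlink k).Edge → H, ∀ r ∈ {r | (unlink k).CoreRel r}, FreeGroup.lift f r = 1 := by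
    rintro f r (⟨e, e', he⟩ | ⟨x, y, z, y', he⟩ | ⟨x, y, z, y', he⟩)
    · have : e = e' := by
        obtain ⟨i, hi⟩ := hP _ he
        simp only [Piece.joint.injEq] at hi
        exact Subtype.ext (hi.1.trans hi.2.symm)
      simp [this]
    all_goals
      obtain ⟨i, hi⟩ := hP _ he
      cases hi
  let E : (unlink k).Edge ≃ Fin k :=
    ⟨fun e => ⟨e.1, (unlink_edge k e.1).1 e.2⟩, fun i => ⟨i.1, (unlink_edge k i.1).2 i.2⟩,
      fun _ => rfl, fun _ => rfl⟩
  rw [Nat.card_congr (presentedGroupHomEquiv _ H),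
    Nat.card_congr (Equiv.subtypeUnivEquiv h), Nat.card_congr (Equiv.arrowCongr E (Equiv.refl H)),
    Nat.card_fun, Nat.card_eq_fintype_card (α := Fin k), Fintype.card_fin]

/-- Homomorphisms from isomorphic groups. -/
def homEquivOfMulEquiv {G G' : Type*} [Group G] [Group G'] (e : G ≃* G') (H : Type*) [Group H] :
    (G →* H) ≃ (G' →* H) where
  toFun φ := φ.comp e.symm.toMonoidHom
  invFun φ := φ.comp e.toMonoidHom
  left_inv φ := by ext; simp
  right_inv φ := by ext; simp

theorem card_coreGroup_hom {n k : ℕ} {D : Diagram} (h : NMoveEquiv n D (unlink k)) {H : Type*}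
    [Group H] (hH : ∀ x : H, x ^ n = 1) : Nat.card (CoreGroup D →* H) = Nat.card H ^ k := by
  obtain ⟨e⟩ := h.burnside
  rw [← card_coreGroup_unlink_hom, ← Nat.card_congr (ModPowers.homEquiv hH),
    ← Nat.card_congr (ModPowers.homEquiv (G := CoreGroup (unlink k)) hH)]
  exact Nat.card_congr (homEquivOfMulEquiv e H)

/-- If the core group of a link that is `n`-move equivalent to the trivial `m`-component link has
a presentation with `m` generators, then the relators hold in all finite groups of exponent `n`. -/
theorem lift_eq_one_of_nMoveEquiv {n m : ℕ} {D : Diagram} {R : Set (FreeGroup (Fin m))}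
    (e : CoreGroup D ≃* PresentedGroup R) (h : NMoveEquiv n D (unlink m)) {H : Type*} [Group H]
    [Finite H] (hH : ∀ x : H, x ^ n = 1) (f : Fin m → H) {r : FreeGroup (Fin m)} (hr : r ∈ R) :
    FreeGroup.lift f r = 1 := by
  have h1 := card_coreGroup_hom h hH
  rw [Nat.card_congr ((homEquivOfMulEquiv e H).trans (presentedGroupHomEquiv R H))] at h1
  have h2 : Nat.card (Fin m → H) = Nat.card H ^ m := by
    rw [Nat.card_fun, Nat.card_eq_fintype_card (α := Fin m), Fintype.card_fin]
  -- The solutions of the relators are a subset of the finite set `H ^ m` with the same cardinality,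
  -- hence all of it.
  have h3 : Function.Bijective
      (Subtype.val : {f : Fin m → H // ∀ r ∈ R, FreeGroup.lift f r = 1} → Fin m → H) :=
    (Nat.bijective_iff_injective_and_card _).2 ⟨Subtype.val_injective, h1.trans h2.symm⟩
  obtain ⟨g, rfl⟩ := h3.2 f
  exact g.2 r hr

/-- In the group of order 2 the relation `z = y * x⁻¹ * y` becomes `z = x`, so homomorphisms from
the core group are functions constant on components, and there are `2 ^ numComponents` of them.
Evenness of `n` makes `n` an exponent of this group. -/
theorem numComponents_eq {n k : ℕ} (hn : Even n) {D : Diagram} (h : NMoveEquiv n D (unlink k)) :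
    D.numComponents = k := by
  obtain ⟨H, _, sq, hcard⟩ : ∃ (H : Type) (_ : CommGroup H), (∀ x : H, x * x = 1) ∧
      Nat.card H = 2 := ⟨Multiplicative (ZMod 2), inferInstance, by decide, Nat.card_zmod 2⟩
  have hinv : ∀ x : H, x⁻¹ = x := fun x => inv_eq_of_mul_eq_one_left (sq x)
  have h1 := card_coreGroup_hom (H := H) h fun x => by
    obtain ⟨j, rfl⟩ := hn
    rw [pow_add, sq]
  have key : ∀ f : D.Edge → H, (∀ r ∈ {r | D.CoreRel r}, FreeGroup.lift f r = 1) ↔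
      ∀ e e', D.Consecutive e e' → f e = f e' := by
    intro f
    constructor
    · rintro hf e e' (⟨b, d, hP⟩ | ⟨a, c, hP⟩ | hP)
      · obtain ⟨y, rfl⟩ : ∃ y : D.Edge, y.1 = b :=
          ⟨⟨b, mem_edgeEnds.2 ⟨_, hP, by simp [Piece.ends]⟩⟩, rfl⟩
        obtain ⟨y', rfl⟩ : ∃ y' : D.Edge, y'.1 = d :=
          ⟨⟨d, mem_edgeEnds.2 ⟨_, hP, by simp [Piece.ends]⟩⟩, rfl⟩
        have := hf _ (Diagram.CoreRel.under e y e' y' hP)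
        simp only [map_mul, map_inv, FreeGroup.lift_apply_of, hinv] at this
        rw [mul_comm (f y), mul_assoc (f e), sq, mul_one] at this
        rw [← hinv (f e'), ← mul_eq_one_iff_eq_inv, this]
      · obtain ⟨x, rfl⟩ : ∃ x : D.Edge, x.1 = a :=
          ⟨⟨a, mem_edgeEnds.2 ⟨_, hP, by simp [Piece.ends]⟩⟩, rfl⟩
        obtain ⟨z, rfl⟩ : ∃ z : D.Edge, z.1 = c :=
          ⟨⟨c, mem_edgeEnds.2 ⟨_, hP, by simp [Piece.ends]⟩⟩, rfl⟩
        have := hf _ (Diagram.CoreRel.over x e z e' hP)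
        simpa only [map_mul, map_inv, FreeGroup.lift_apply_of, mul_inv_eq_one] using this
      · have := hf _ (Diagram.CoreRel.joint e e' hP)
        simpa only [map_mul, map_inv, FreeGroup.lift_apply_of, mul_inv_eq_one] using this
    · rintro hf r (⟨e, e', he⟩ | ⟨x, y, z, y', he⟩ | ⟨x, y, z, y', he⟩)
      · rw [map_mul, map_inv, FreeGroup.lift_apply_of, FreeGroup.lift_apply_of,
          hf e e' (Or.inr (Or.inr he)), mul_inv_cancel]
      · rw [map_mul, map_inv, FreeGroup.lift_apply_of, FreeGroup.lift_apply_of,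
          hf y y' (Or.inr (Or.inl ⟨_, _, he⟩)), mul_inv_cancel]
      · have := hf x z (Or.inl ⟨_, _, he⟩)
        simp only [map_mul, map_inv, FreeGroup.lift_apply_of, hinv, this]
        rw [mul_comm (f y), mul_assoc (f z), sq, mul_one, sq]
  let E : {f : D.Edge → H // ∀ r ∈ {r | D.CoreRel r}, FreeGroup.lift f r = 1} ≃
      (Quot D.Consecutive → H) :=
    { toFun f := Quot.lift f.1 ((key f.1).1 f.2)
      invFun g := ⟨fun e => g (Quot.mk _ e), (key _).2 fun e e' he => by rw [Quot.sound he]⟩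
      left_inv f := rfl
      right_inv g := by ext ⟨e⟩; rfl }
  have : Finite D.Edge := Finite.of_injective
    (fun e : D.Edge => (⟨e.1, Multiset.mem_toFinset.2 e.2⟩ : (edgeEnds D.pieces).toFinset))
    fun e e' h => Subtype.ext (congrArg (fun x => x.1) h)
  have : Finite (Quot D.Consecutive) := inferInstance
  rw [Nat.card_congr ((presentedGroupHomEquiv _ H).trans E), Nat.card_fun, hcard] at h1
  exact Nat.pow_right_injective le_rfl h1

end Welded

/-! ### Leading forms of Magnus expansions -/

namespace NCSeries

variable {σ R : Type*} [Ring R]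

/-- The series all of whose terms have degree at least `k`. -/
def HasOrderGE (k : ℕ) (f : NCSeries σ R) : Prop := ∀ w : List σ, w.length < k → f w = 0

theorem neg_apply (f : NCSeries σ R) (w : List σ) : (-f) w = -f w := rfl

theorem sub_apply (f g : NCSeries σ R) (w : List σ) : (f - g) w = f w - g w := rfl

theorem HasOrderGE.add {k : ℕ} {f g : NCSeries σ R} (hf : f.HasOrderGE k) (hg : g.HasOrderGE k) :
    (f + g).HasOrderGE k := fun w hw => by rw [add_apply, hf w hw, hg w hw, add_zero]

theorem HasOrderGE.neg {k : ℕ} {f : NCSeries σ R} (hf : f.HasOrderGE k) :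
    (-f).HasOrderGE k := fun w hw => by rw [neg_apply, hf w hw, neg_zero]

theorem HasOrderGE.mono {k l : ℕ} (h : k ≤ l) {f : NCSeries σ R} (hf : f.HasOrderGE l) :
    f.HasOrderGE k := fun w hw => hf w (hw.trans_le h)

theorem HasOrderGE.mul {k l : ℕ} {f g : NCSeries σ R} (hf : f.HasOrderGE k)
    (hg : g.HasOrderGE l) : (f * g).HasOrderGE (k + l) := by
  intro w hw
  rw [mul_apply]
  refine Finset.sum_eq_zero fun i hi => ?_
  rw [Finset.mem_range] at hi
  by_cases h : i < k
  · rw [hf _ (by rw [List.length_take]; omega), zero_mul]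
  · rw [hg _ (by rw [List.length_drop]; omega), mul_zero]

theorem hasOrderGE_zero (f : NCSeries σ R) : f.HasOrderGE 0 := fun _ hw => absurd hw (by simp)

theorem HasOrderGE.mul_right {k : ℕ} {f : NCSeries σ R} (hf : f.HasOrderGE k)
    (g : NCSeries σ R) : (f * g).HasOrderGE k := hf.mul (hasOrderGE_zero g)

theorem HasOrderGE.mul_left {k : ℕ} {f : NCSeries σ R} (hf : f.HasOrderGE k)
    (g : NCSeries σ R) : (g * f).HasOrderGE k := by
  simpa using (hasOrderGE_zero g).mul hf

/-- The series without terms of degree less than `k` whose terms of degree `k` are invariant under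
permutations of the positions. -/
structure IsSymmetricForm (k : ℕ) (f : NCSeries σ R) : Prop where
  order : f.HasOrderGE k
  perm : ∀ w w' : List σ, w.length = k → w.Perm w' → f w = f w'

theorem IsSymmetricForm.add {k : ℕ} {f g : NCSeries σ R} (hf : f.IsSymmetricForm k)
    (hg : g.IsSymmetricForm k) : (f + g).IsSymmetricForm k :=
  ⟨hf.1.add hg.1, fun w w' hw h => by
    rw [add_apply, add_apply, hf.2 w w' hw h, hg.2 w w' hw h]⟩

theorem IsSymmetricForm.neg {k : ℕ} {f : NCSeries σ R} (hf : f.IsSymmetricForm k) :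
    (-f).IsSymmetricForm k :=
  ⟨hf.1.neg, fun w w' hw h => by rw [neg_apply, neg_apply, hf.2 w w' hw h]⟩

theorem HasOrderGE.isSymmetricForm {k : ℕ} {f : NCSeries σ R} (hf : f.HasOrderGE (k + 1)) :
    f.IsSymmetricForm k :=
  ⟨hf.mono k.le_succ, fun w w' hw h => by
    rw [hf w (by omega), hf w' (by rw [← h.length_eq]; omega)]⟩

/-- As `Y` has no constant term, a word of length `n` gets a contribution to `Y ^ n` only from its
factorization into single letters. Over a commutative ring the result is invariant under
permutations of the word. -/
theorem pow_apply_of_length_eq {Y : NCSeries σ R} (hY : Y.HasOrderGE 1) (w : List σ) :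
    (Y ^ w.length) w = (w.map fun a => Y [a]).prod := by
  have hpow : ∀ n : ℕ, (Y ^ n).HasOrderGE n := by
    intro n
    induction n with
    | zero => exact hasOrderGE_zero _
    | succ n ih => rw [pow_succ]; exact ih.mul hY
  induction w with
  | nil => simp [one_nil]
  | cons a w ih =>
    rw [List.length_cons, pow_succ', mul_cons, hY [] (by simp), zero_mul, zero_add, mul_apply,
      Finset.sum_eq_single 0, List.map_cons, List.prod_cons, ← ih]
    · rfl
    · intro i hi hi0
      rw [Finset.mem_range] at hi
      rw [hpow _ (w.drop i) (by rw [List.length_drop]; omega), mul_zero]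
    · simp

/-- Needed for the Frobenius identity in `pow_mem_symmetricSubgroup`. -/
theorem charP (p : ℕ) [CharP R p] : CharP (NCSeries σ R) p := by
  have h : ∀ n : ℕ, (n : NCSeries σ R) = (n : R) • (1 : NCSeries σ R) := by
    intro n
    induction n with
    | zero => simp
    | succ n ih => rw [Nat.cast_succ, ih, Nat.cast_succ, add_smul, one_smul]
  refine ⟨fun n => ?_⟩
  rw [← CharP.cast_eq_zero_iff R p n]
  constructor
  · intro hn
    have := congrFun ((h n).symm.trans hn) []
    rwa [smul_apply, one_nil, mul_one] at this
  · intro hn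
    rw [h, hn, zero_smul]

open Classical in
theorem prod_X_apply (v w : List σ) :
    (v.map fun i => (X i : NCSeries σ R)).prod w = if w = v then 1 else 0 := by
  induction v generalizing w with
  | nil => rfl
  | cons i v ih =>
    rw [List.map_cons, List.prod_cons]
    cases w with
    | nil => rw [mul_nil]; simp [X]
    | cons a w =>
      have hnil : (X i : NCSeries σ R) [] = 0 := by simp [X]
      rw [mul_cons, hnil, zero_mul, zero_add]
      by_cases h : a = i
      · have e : tail a (X i : NCSeries σ R) = 1 := by
          ext u
          rw [tail_apply]
          cases u <;> simp [X, h, one_nil, one_cons]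
        rw [e, one_mul, ih]
        simp [h]
      · have e : tail a (X i : NCSeries σ R) = 0 := by
          ext u
          rw [tail_apply, zero_apply]
          simp [X, h]
        rw [e, zero_mul, zero_apply]
        simp [h]

theorem IsSymmetricForm.hasSymmetricLeadingForm {m k : ℕ} {f : NCSeries (Fin m) R}
    (h : (f - 1).IsSymmetricForm k) : HasSymmetricLeadingForm k f := by
  classical
  -- The coefficients are read off at the words of length `k`; `s` is then the homogeneous part of
  -- degree `k` of `f - 1`, and the remainder starts in degree `k + 1`.
  let c : (Fin k → Fin m) → R := fun i => (f - 1) (List.ofFn i)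
  let s : NCSeries (Fin m) R := ∑ i : Fin k → Fin m,
    c i • (List.ofFn fun j => (X (i j) : NCSeries (Fin m) R)).prod
  have hsum : ∀ (F : (Fin k → Fin m) → NCSeries (Fin m) R) (w : List (Fin m)),
      (∑ i, F i) w = ∑ i, F i w := fun F w => Finset.sum_apply w _ F
  have hs : ∀ w, s w = if w.length = k then (f - 1) w else 0 := by
    intro w
    have h1 : ∀ i : Fin k → Fin m,
        (c i • (List.ofFn fun j => (X (i j) : NCSeries (Fin m) R)).prod) w =
          if w = List.ofFn i then (f - 1) w else 0 := by
      intro i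
      have h2 : (List.ofFn fun j => (X (i j) : NCSeries (Fin m) R)) =
          (List.ofFn i).map fun a => X a := by rw [List.map_ofFn]; rfl
      rw [smul_apply, h2, prod_X_apply]
      by_cases h : w = List.ofFn i
      · simp [h, c]
      · simp [h]
    refine (hsum _ w).trans ?_
    rw [Finset.sum_congr rfl fun i _ => h1 i]
    split_ifs with hw
    · subst hw
      rw [Finset.sum_eq_single w.get]
      · rw [List.ofFn_get, if_pos rfl]
      · intro i _ hi
        rw [if_neg]
        intro h
        apply hi
        apply List.ofFn_injective
        rw [← h, List.ofFn_get]
      · simp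
    · refine Finset.sum_eq_zero fun i _ => if_neg ?_
      rintro rfl
      exact hw (List.length_ofFn)
  refine ⟨c, f - 1 - s, fun p i => ?_, fun w hw => ?_, by simp only [s]; abel⟩
  · exact h.2 _ _ (List.length_ofFn) (Equiv.Perm.ofFn_comp_perm p i).symm
  · change (f - 1 - s) w = 0
    rw [sub_apply, hs]
    split_ifs with hk
    · exact sub_self _
    · rw [sub_zero, h.1 w (by omega)]

end NCSeries

/-! ### The finite-index normal subgroup of words with symmetric leading form -/

section Magnus

open NCSeries

variable {m : ℕ} {p : ℕ}

theorem magnus_sub_one_order (g : FreeGroup (Fin m)) :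
    ((magnus p m g : NCSeries (Fin m) (ZMod p)) - 1).HasOrderGE 1 := by
  have key : (magnus p m g : NCSeries (Fin m) (ZMod p)) [] = 1 := by
    induction g using FreeGroup.induction_on with
    | C1 => rw [map_one]; exact one_nil
    | of i => rw [magnus, FreeGroup.lift_apply_of]; exact one_add_X_nil i
    | inv_of i _ =>
      rw [magnus, map_inv, FreeGroup.lift_apply_of]; exact altGeom_nil i
    | mul g h hg hh => rw [map_mul, Units.val_mul, mul_nil, hg, hh, mul_one]
  intro w hw
  have : w = [] := by simpa using hw
  rw [this, NCSeries.sub_apply, key, one_nil, sub_self]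

/-- The elements of the free group whose Magnus expansion has symmetric terms of degree `k` and no
other non-constant terms of degree at most `k`. -/
def symmetricSubgroup (p m k : ℕ) (hk : 1 ≤ k) : Subgroup (FreeGroup (Fin m)) where
  carrier := {g | ((magnus p m g : NCSeries (Fin m) (ZMod p)) - 1).IsSymmetricForm k}
  one_mem' := by
    rw [Set.mem_ofPred_eq, map_one, Units.val_one, sub_self]
    exact ⟨fun _ _ => rfl, fun _ _ _ _ => rfl⟩
  mul_mem' := by
    intro a b ha hb
    rw [Set.mem_ofPred_eq] at *
    have : (magnus p m (a * b) : NCSeries (Fin m) (ZMod p)) - 1 =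
        ((magnus p m a : NCSeries (Fin m) (ZMod p)) - 1) +
        ((magnus p m b : NCSeries (Fin m) (ZMod p)) - 1) +
        ((magnus p m a : NCSeries (Fin m) (ZMod p)) - 1) *
          ((magnus p m b : NCSeries (Fin m) (ZMod p)) - 1) := by
      rw [map_mul, Units.val_mul]; noncomm_ring
    rw [this]
    -- The cross term has order at least `2 * k ≥ k + 1`, because `k ≥ 1`; the leading forms simply
    -- add.
    exact (ha.add hb).add ((ha.1.mul hb.1).mono (by omega)).isSymmetricForm
  inv_mem' := by
    intro a ha
    rw [Set.mem_ofPred_eq] at *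
    have h1 : (magnus p m a : NCSeries (Fin m) (ZMod p)) *
        (magnus p m a⁻¹ : NCSeries (Fin m) (ZMod p)) = 1 := by
      rw [map_inv, Units.mul_inv]
    have : (magnus p m a⁻¹ : NCSeries (Fin m) (ZMod p)) - 1 =
        -((magnus p m a : NCSeries (Fin m) (ZMod p)) - 1) +
        -(((magnus p m a : NCSeries (Fin m) (ZMod p)) - 1) *
          ((magnus p m a⁻¹ : NCSeries (Fin m) (ZMod p)) - 1)) := by
      rw [sub_mul, mul_sub, mul_sub, h1]; noncomm_ring
    rw [this]
    exact ha.neg.add (ha.1.mul (magnus_sub_one_order a⁻¹)).isSymmetricForm.neg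

theorem mem_symmetricSubgroup {k : ℕ} {hk : 1 ≤ k} {g : FreeGroup (Fin m)} :
    g ∈ symmetricSubgroup p m k hk ↔
      ((magnus p m g : NCSeries (Fin m) (ZMod p)) - 1).IsSymmetricForm k := Iff.rfl

/-- Conjugation changes `E(a) - 1` only by its products with series without constant term, hence
only in degrees above `k`. -/
instance symmetricSubgroup_normal (k : ℕ) (hk : 1 ≤ k) : (symmetricSubgroup p m k hk).Normal := by
  refine ⟨fun a ha g => ?_⟩
  rw [mem_symmetricSubgroup] at *
  have h1 : (magnus p m g : NCSeries (Fin m) (ZMod p)) *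
      (magnus p m g⁻¹ : NCSeries (Fin m) (ZMod p)) = 1 := by
    rw [map_inv, Units.mul_inv]
  have : (magnus p m (g * a * g⁻¹) : NCSeries (Fin m) (ZMod p)) - 1 =
      ((magnus p m a : NCSeries (Fin m) (ZMod p)) - 1) +
      (((magnus p m g : NCSeries (Fin m) (ZMod p)) - 1) *
        ((magnus p m a : NCSeries (Fin m) (ZMod p)) - 1) *
          (magnus p m g⁻¹ : NCSeries (Fin m) (ZMod p)) +
      ((magnus p m a : NCSeries (Fin m) (ZMod p)) - 1) *
        ((magnus p m g⁻¹ : NCSeries (Fin m) (ZMod p)) - 1)) := by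
    rw [map_mul, map_mul, Units.val_mul, Units.val_mul]
    conv_lhs => rw [← h1]
    noncomm_ring
  rw [this]
  refine ha.add (HasOrderGE.add ?_ (ha.1.mul (magnus_sub_one_order g⁻¹))).isSymmetricForm
  rw [add_comm k 1]
  exact ((magnus_sub_one_order g).mul ha.1).mul_right _

/-- In characteristic `p`, `E(g) ^ p ^ a - 1 = (E(g) - 1) ^ p ^ a`, and `pow_apply_of_length_eq`
describes the leading coefficients of this power. -/
theorem pow_mem_symmetricSubgroup [Fact p.Prime] (a : ℕ) (g : FreeGroup (Fin m)) :
    g ^ p ^ a ∈ symmetricSubgroup p m (p ^ a) (Nat.one_le_pow _ _ (Fact.out : p.Prime).pos) := by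
  have := NCSeries.charP (σ := Fin m) (R := ZMod p) p
  have hY := magnus_sub_one_order (p := p) g
  rw [mem_symmetricSubgroup, map_pow, Units.val_pow_eq_pow_val]
  have h1 : (magnus p m g : NCSeries (Fin m) (ZMod p)) ^ p ^ a - 1 =
      ((magnus p m g : NCSeries (Fin m) (ZMod p)) - 1) ^ p ^ a := by
    rw [sub_pow_char_pow_of_commute _ _ (Commute.one_right _), one_pow]
  rw [h1]
  refine ⟨?_, fun w w' hw h => ?_⟩
  · have hpow : ∀ n : ℕ,
        (((magnus p m g : NCSeries (Fin m) (ZMod p)) - 1) ^ n).HasOrderGE n := by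
      intro n
      induction n with
      | zero => exact hasOrderGE_zero _
      | succ n ih => rw [pow_succ]; exact ih.mul hY
    exact hpow _
  · rw [← hw, pow_apply_of_length_eq hY, h.length_eq, pow_apply_of_length_eq hY]
    exact (h.map _).prod_eq

/-- A coset is determined by the coefficients in degrees at most `k` of a chosen representative: if
two agree there, their quotient has expansion `1 + d(k + 1)`. There are finitely many such words,
with coefficients in a finite ring. -/
instance finite_quotient_symmetricSubgroup [NeZero p] (k : ℕ) (hk : 1 ≤ k) :
    Finite (FreeGroup (Fin m) ⧸ symmetricSubgroup p m k hk) := by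
  have hfin : Finite {w : List (Fin m) // w.length ≤ k} := (List.finite_length_le (Fin m) k)
  refine Finite.of_injective (β := {w : List (Fin m) // w.length ≤ k} → ZMod p)
    (fun x w => (magnus p m x.out : NCSeries (Fin m) (ZMod p)) w.1) fun x y hxy => ?_
  have h1 : ((magnus p m y.out : NCSeries (Fin m) (ZMod p)) -
      (magnus p m x.out : NCSeries (Fin m) (ZMod p))).HasOrderGE (k + 1) := by
    intro w hw
    have : (magnus p m x.out : NCSeries (Fin m) (ZMod p)) w =
        (magnus p m y.out : NCSeries (Fin m) (ZMod p)) w := congrFun hxy ⟨w, by omega⟩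
    rw [NCSeries.sub_apply, this, sub_self]
  rw [← x.out_eq', ← y.out_eq', QuotientGroup.eq, mem_symmetricSubgroup]
  have h2 : (magnus p m (x.out⁻¹ * y.out) : NCSeries (Fin m) (ZMod p)) - 1 =
      (magnus p m x.out⁻¹ : NCSeries (Fin m) (ZMod p)) *
      ((magnus p m y.out : NCSeries (Fin m) (ZMod p)) -
        (magnus p m x.out : NCSeries (Fin m) (ZMod p))) := by
    rw [map_mul, Units.val_mul, map_inv, mul_sub, Units.inv_mul]
  rw [h2]
  exact (h1.mul_left _).isSymmetricForm

end Magnus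

namespace Welded

/-- If the core group of a link that is `p ^ a`-move equivalent to the trivial `m`-component link
has a presentation with `m` generators, then the Magnus expansions of the relators have symmetric
leading forms of degree `p ^ a`. -/
theorem isSymmetricForm_of_nMoveEquiv {p a m : ℕ} (hp : p.Prime) {D : Diagram}
    {R : Set (FreeGroup (Fin m))} (e : CoreGroup D ≃* PresentedGroup R)
    (h : NMoveEquiv (p ^ a) D (unlink m)) {r : FreeGroup (Fin m)} (hr : r ∈ R) :
    ((magnus p m r : NCSeries (Fin m) (ZMod p)) - 1).IsSymmetricForm (p ^ a) := by
  have : Fact p.Prime := ⟨hp⟩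
  have hk : 1 ≤ p ^ a := Nat.one_le_pow _ _ hp.pos
  have hH : ∀ x : FreeGroup (Fin m) ⧸ symmetricSubgroup p m (p ^ a) hk, x ^ p ^ a = 1 := by
    intro x
    obtain ⟨g, rfl⟩ := QuotientGroup.mk_surjective x
    rw [← QuotientGroup.mk_pow, QuotientGroup.eq_one_iff]
    exact pow_mem_symmetricSubgroup a g
  -- Evaluating `r` at the classes of the free generators gives the class of `r` itself.
  have h1 := lift_eq_one_of_nMoveEquiv e h hH
    (fun i => QuotientGroup.mk' _ (FreeGroup.of i)) hr
  have h2 : FreeGroup.lift (fun i => QuotientGroup.mk' (symmetricSubgroup p m (p ^ a) hk)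
      (FreeGroup.of i)) = QuotientGroup.mk' _ := by ext; simp
  rw [h2] at h1
  exact (QuotientGroup.eq_one_iff r).1 h1

end Welded

/-! ### Elementary abelian quotients and the rank -/

section ElementaryAbelian

variable {p m : ℕ}

theorem existsUnique_addHom_of_exponent {A : Type*} [AddCommGroup A] (hA : ∀ x : A, p • x = 0)
    (f : Fin m → A) : ∃! φ : (Fin m → ZMod p) →+ A, ∀ i, φ (Pi.single i 1) = f i := by
  obtain ⟨_⟩ : Nonempty (Module (ZMod p) A) := ⟨AddCommGroup.zmodModule hA⟩
  have hL : ∀ i, (Pi.basisFun (ZMod p) (Fin m)).constr (ZMod p) f (Pi.single i 1) = f i := by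
    intro i
    rw [← Pi.basisFun_apply, Module.Basis.constr_basis]
  refine ⟨((Pi.basisFun (ZMod p) (Fin m)).constr (ZMod p) f).toAddMonoidHom, hL, fun ψ hψ => ?_⟩
  have h : ψ.toZModLinearMap p = (Pi.basisFun (ZMod p) (Fin m)).constr (ZMod p) f := by
    refine (Pi.basisFun (ZMod p) (Fin m)).ext fun i => ?_
    rw [Pi.basisFun_apply, hL]
    exact hψ i
  refine AddMonoidHom.ext fun x => ?_
  exact LinearMap.congr_fun h x

/-- The elementary abelian group of rank `m` is free among the abelian groups of exponent `p`. -/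
theorem existsUnique_hom_of_exponent {A : Type*} [CommGroup A] (hA : ∀ x : A, x ^ p = 1)
    (f : Fin m → A) : ∃! φ : Multiplicative (Fin m → ZMod p) →* A,
      ∀ i, φ (Multiplicative.ofAdd (Pi.single i 1)) = f i := by
  obtain ⟨L, hL, huniq⟩ := existsUnique_addHom_of_exponent (A := Additive A)
    (fun x => hA x.toMul) (fun i => Additive.ofMul (f i))
  refine ⟨AddMonoidHom.toMultiplicativeLeft L, hL, fun ψ hψ => ?_⟩
  rw [← huniq (MonoidHom.toAdditiveRight ψ) hψ]
  rfl

theorem card_elementaryAbelian_hom [NeZero p] :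
    Nat.card (Multiplicative (Fin m → ZMod p) →* Multiplicative (ZMod p)) = p ^ m := by
  have hA : ∀ x : Multiplicative (ZMod p), x ^ p = 1 := fun x => by
    rw [← ofAdd_toAdd x, ← ofAdd_nsmul]; simp
  have h : Function.Bijective (fun (φ : Multiplicative (Fin m → ZMod p) →* Multiplicative (ZMod p))
      (i : Fin m) => φ (Multiplicative.ofAdd (Pi.single i 1))) := by
    constructor
    · intro φ ψ h
      exact (existsUnique_hom_of_exponent hA _).unique (congrFun h) fun _ => rfl
    · intro f
      obtain ⟨φ, hφ, -⟩ := existsUnique_hom_of_exponent hA f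
      exact ⟨φ, funext hφ⟩
  rw [Nat.card_congr (Equiv.ofBijective _ h), Nat.card_fun, Nat.card_eq_fintype_card (α := Fin m),
    Fintype.card_fin]
  exact congrArg (· ^ m) (Nat.card_zmod p)

/-- Homomorphisms to abelian groups factor through the quotient by the second term of the lower
central series. -/
def abelianQuotientHomEquiv (G A : Type*) [Group G] [CommGroup A] :
    (G ⧸ (⊤ : Subgroup G).lowerCentralSeries 1 →* A) ≃ (G →* A) where
  toFun φ := φ.comp (QuotientGroup.mk' _)
  invFun φ := QuotientGroup.lift _ φ <| by
    refine (Subgroup.commutator_le.2 fun a _ b _ => ?_ : ⁅(⊤ : Subgroup G), ⊤⁆ ≤ φ.ker)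
    rw [MonoidHom.mem_ker, map_commutatorElement, commutatorElement_eq_one_iff_mul_comm, mul_comm]
  left_inv φ := by ext; rfl
  right_inv φ := by ext; rfl

theorem abelianQuotient_mul_comm {G : Type*} [Group G]
    (x y : G ⧸ (⊤ : Subgroup G).lowerCentralSeries 1) : x * y = y * x := by
  obtain ⟨a, rfl⟩ := QuotientGroup.mk_surjective x
  obtain ⟨b, rfl⟩ := QuotientGroup.mk_surjective y
  rw [← commutatorElement_eq_one_iff_mul_comm]
  have h := Subgroup.commutator_mem_commutator (Subgroup.mem_top a) (Subgroup.mem_top b)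
  have h' := (QuotientGroup.eq_one_iff (N := (⊤ : Subgroup G).lowerCentralSeries 1) _).2 h
  exact h'

end ElementaryAbelian

namespace Welded

/-- Homomorphisms from the core group to `ℤ_p` number `p ^ k` by the move equivalence and `p ^ m` by
the elementary abelian quotient. -/
theorem rank_eq_of_nMoveEquiv {p k m : ℕ} (hp : p.Prime) {D : Diagram}
    (e : BurnsideGroup₂ p D ≃* Multiplicative (Fin m → ZMod p))
    (h : NMoveEquiv p D (unlink k)) : k = m := by
  have : NeZero p := ⟨hp.ne_zero⟩
  have hA : ∀ x : Multiplicative (ZMod p), x ^ p = 1 := fun x => by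
    rw [← ofAdd_toAdd x, ← ofAdd_nsmul]; simp
  have h1 := card_coreGroup_hom h hA
  rw [← Nat.card_congr (ModPowers.homEquiv hA), ← Nat.card_congr (abelianQuotientHomEquiv _ _),
    Nat.card_congr (homEquivOfMulEquiv e _), card_elementaryAbelian_hom,
    show Nat.card (Multiplicative (ZMod p)) = p from Nat.card_zmod p] at h1
  exact (Nat.pow_right_injective hp.two_le h1).symm

/-- If all relators of a presentation of the core group lie in the commutator subgroup, then the
abelianized Burnside group is elementary abelian of full rank. -/
theorem burnside₂_mulEquiv {p m : ℕ} {D : Diagram} {R : Set (FreeGroup (Fin m))}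
    (e : CoreGroup D ≃* PresentedGroup R)
    (hR : ∀ (A : Type) [CommGroup A] (f : Fin m → A), ∀ r ∈ R, FreeGroup.lift f r = 1) :
    Nonempty (BurnsideGroup₂ p D ≃* Multiplicative (Fin m → ZMod p)) := by
  let _ : CommGroup (BurnsideGroup₂ p D) :=
    { (inferInstance : Group (BurnsideGroup₂ p D)) with mul_comm := abelianQuotient_mul_comm }
  let q : CoreGroup D →* BurnsideGroup₂ p D :=
    (QuotientGroup.mk' _).comp (QuotientGroup.mk' _)
  have hA : ∀ x : Multiplicative (Fin m → ZMod p), x ^ p = 1 := fun x => by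
    rw [← ofAdd_toAdd x, ← ofAdd_nsmul]
    refine congrArg Multiplicative.ofAdd ?_
    ext i; simp
  have hB : ∀ x : BurnsideGroup₂ p D, x ^ p = 1 := by
    intro x
    obtain ⟨y, rfl⟩ := QuotientGroup.mk_surjective x
    rw [← QuotientGroup.mk_pow, ModPowers.pow_eq_one, QuotientGroup.mk_one]
  let b : Fin m → Multiplicative (Fin m → ZMod p) := fun i => Multiplicative.ofAdd (Pi.single i 1)
  let φ₀ : PresentedGroup R →* Multiplicative (Fin m → ZMod p) :=
    PresentedGroup.toGroup (hR _ b)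
  -- The map `φ₀ ∘ e` factors through both quotients because the target is abelian of exponent `p`;
  -- its inverse `ψ` comes from the freeness of the target among such groups.
  let φ : BurnsideGroup₂ p D →* Multiplicative (Fin m → ZMod p) :=
    (abelianQuotientHomEquiv _ _).symm ((ModPowers.homEquiv hA).symm (φ₀.comp e.toMonoidHom))
  have hφ : ∀ x, φ (q x) = φ₀ (e x) := fun _ => rfl
  obtain ⟨ψ, hψ, -⟩ := existsUnique_hom_of_exponent hB fun i => q (e.symm (PresentedGroup.of i))
  have h0 : ∀ i, φ (q (e.symm (PresentedGroup.of i))) = b i := by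
    intro i
    rw [hφ, e.apply_symm_apply]
    exact PresentedGroup.toGroup.of _
  refine ⟨MonoidHom.toMulEquiv φ ψ ?_ ?_⟩
  · have h1 : ((ψ.comp φ).comp q).comp e.symm.toMonoidHom = q.comp e.symm.toMonoidHom := by
      refine PresentedGroup.ext fun i => ?_
      change ψ (φ (q (e.symm (PresentedGroup.of i)))) = _
      rw [h0, hψ]; rfl
    refine QuotientGroup.monoidHom_ext _ (QuotientGroup.monoidHom_ext _ ?_)
    refine MonoidHom.ext fun x => ?_
    have h2 := DFunLike.congr_fun h1 (e x)
    simp only [MonoidHom.comp_apply, MulEquiv.toMonoidHom_eq_coe, MonoidHom.coe_coe,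
      e.symm_apply_apply] at h2
    exact h2
  · refine (existsUnique_hom_of_exponent hA b).unique (fun i => ?_) fun i => rfl
    rw [MonoidHom.comp_apply, hψ, h0]

end Welded

/-! ### Evaluating coefficients -/

namespace NCSeries

variable {σ R : Type*} [Ring R]

theorem one_add_X_mul_cons [DecidableEq σ] (i a : σ) (g : NCSeries σ R) (w : List σ) :
    ((1 + X i) * g : NCSeries σ R) (a :: w) = g (a :: w) + if a = i then g w else 0 := by
  rw [mul_cons, one_add_X_nil, one_mul]
  congr 1
  split_ifs with h
  · have e : tail a (1 + X i : NCSeries σ R) = 1 := by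
      ext v; rw [h]; exact one_add_X_cons_self i v
    rw [e, one_mul]
  · have e : tail a (1 + X i : NCSeries σ R) = 0 := by
      ext v; exact one_add_X_cons_ne h v
    rw [e, zero_mul]; rfl

/-- The recursion `A * g = g - X_i * (A * g)` for `A = (1 + X_i)⁻¹`, read on first letters. The word
gets shorter, so rewriting terminates. -/
theorem altGeom_mul_cons [DecidableEq σ] (i a : σ) (g : NCSeries σ R) (w : List σ) :
    (altGeom i * g : NCSeries σ R) (a :: w) =
      g (a :: w) - if a = i then (altGeom i * g : NCSeries σ R) w else 0 := by
  rw [mul_cons, altGeom_nil, one_mul, sub_eq_add_neg]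
  congr 1
  split_ifs with h
  · have e : tail a (altGeom i : NCSeries σ R) = (-1 : R) • altGeom i := by
      ext v; rw [h, tail_apply, altGeom_cons_self, smul_apply, neg_one_mul]
    rw [e, NCSeries.smul_mul, smul_apply, neg_one_mul]
  · have e : tail a (altGeom i : NCSeries σ R) = 0 := by
      ext v; exact altGeom_cons_ne h v
    rw [e, zero_mul, neg_zero]; rfl

theorem one_add_X_mul_nil (i : σ) (g : NCSeries σ R) : ((1 + X i) * g : NCSeries σ R) [] = g [] := by
  rw [mul_nil, one_add_X_nil, one_mul]

theorem altGeom_mul_nil (i : σ) (g : NCSeries σ R) : (altGeom i * g : NCSeries σ R) [] = g [] := by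
  rw [mul_nil, altGeom_nil, one_mul]

end NCSeries

namespace Welded

theorem magnus_of (p m : ℕ) (i : Fin m) :
    (magnus p m (FreeGroup.of i) : NCSeries (Fin m) (ZMod p)) = 1 + NCSeries.X i := by
  rw [magnus, FreeGroup.lift_apply_of]; rfl

theorem magnus_of_inv (p m : ℕ) (i : Fin m) :
    (magnus p m (FreeGroup.of i)⁻¹ : NCSeries (Fin m) (ZMod p)) = NCSeries.altGeom i := by
  rw [magnus, map_inv, FreeGroup.lift_apply_of]; rfl

/-- The product is nested to the right and ends in `* 1`, so that the coefficient recursions apply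
to every factor, including the last. -/
theorem magnus_Q₃ (p : ℕ) : (magnus p 4 (Q₃ * (FreeGroup.of 2)⁻¹) : NCSeries (Fin 4) (ZMod p)) =
    (1 + NCSeries.X 3) * (NCSeries.altGeom 0 * ((1 + NCSeries.X 1) * (NCSeries.altGeom 3 *
    ((1 + NCSeries.X 0) * (NCSeries.altGeom 1 * ((1 + NCSeries.X 2) * (NCSeries.altGeom 1 *
    ((1 + NCSeries.X 0) * (NCSeries.altGeom 3 * ((1 + NCSeries.X 1) * (NCSeries.altGeom 0 *
    ((1 + NCSeries.X 3) * (NCSeries.altGeom 2 * 1))))))))))))) := by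
  rw [Q₃]
  simp only [map_mul, Units.val_mul, magnus_of, magnus_of_inv, mul_assoc, mul_one]

theorem coeff_magnus_Q₃ (p : ℕ) :
    NCSeries.coeff [3, 1, 2] (magnus p 4 (Q₃ * (FreeGroup.of 2)⁻¹) :
      NCSeries (Fin 4) (ZMod p)) = 1 ∧
    NCSeries.coeff [3, 2, 1] (magnus p 4 (Q₃ * (FreeGroup.of 2)⁻¹) :
      NCSeries (Fin 4) (ZMod p)) = 0 := by
  rw [magnus_Q₃]
  -- `mul_one` is switched off to keep the final `* 1`, which the recursions need.
  simp [NCSeries.coeff, NCSeries.one_add_X_mul_cons, NCSeries.altGeom_mul_cons,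
    NCSeries.one_add_X_mul_nil, NCSeries.altGeom_mul_nil, NCSeries.one_nil, NCSeries.one_cons,
    -mul_one]

/-- All exponent sums of the relator vanish. The computation is moved to `Additive A`. -/
theorem lift_Q₃_comm {A : Type*} [CommGroup A] (f : Fin 4 → A) :
    FreeGroup.lift f (Q₃ * (FreeGroup.of 2)⁻¹) = 1 := by
  have h : ∀ a b c d : A, d * a⁻¹ * b * d⁻¹ * a * b⁻¹ * c * b⁻¹ * a * d⁻¹ * b * a⁻¹ * d * c⁻¹ = 1 := by
    intro a b c d
    have h' : ∀ a b c d : Additive A,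
        d + -a + b + -d + a + -b + c + -b + a + -d + b + -a + d + -c = 0 := by
      intro a b c d; abel
    exact h' (Additive.ofMul a) (Additive.ofMul b) (Additive.ofMul c) (Additive.ofMul d)
  simpa [Q₃] using h (f 0) (f 1) (f 2) (f 3)

theorem terminalLabels_braidB : terminalLabels braidB = labelsB := by
  funext j
  fin_cases j <;>
  simp [terminalLabels, braidB, labelsB, Q₃, BraidLetter.act, mul_assoc, Fin.ext_iff]

end Welded

namespace Welded

/-! ### Colourings of closed braids -/

section Braid

variable {n : ℕ} {G H : Type*} [Group G] [Group H]

theorem BraidLetter.map_act (φ : G →* H) (f : Fin (n + 1) → G) (g : BraidLetter n) :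
    g.act (φ ∘ f) = φ ∘ g.act f := by
  cases g <;>
  · funext j
    simp only [BraidLetter.act, Function.update_apply, Function.comp_apply]
    split_ifs <;> simp

theorem map_foldl_act (φ : G →* H) (w : List (BraidLetter n)) (f : Fin (n + 1) → G) :
    w.foldl BraidLetter.act (φ ∘ f) = φ ∘ w.foldl BraidLetter.act f := by
  induction w generalizing f with
  | nil => rfl
  | cons g w ih => rw [List.foldl_cons, BraidLetter.map_act, ih, List.foldl_cons]

/-- By naturality, transporting labels along a braid in any group amounts to substituting the
initial labels into the universal words `terminalLabels w`. -/
theorem foldl_act_eq (w : List (BraidLetter n)) (f : Fin (n + 1) → G) :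
    w.foldl BraidLetter.act f = FreeGroup.lift f ∘ terminalLabels w := by
  rw [terminalLabels, ← map_foldl_act]
  congr 1
  funext j
  simp

/-- The labels in column `t`. -/
def columnLabels (n : ℕ) (g : ℕ → G) (t : ℕ) : Fin (n + 1) → G := fun j => g (braidEdge t j)

theorem isColoring_layer {g : ℕ → G} (t : ℕ) (a : BraidLetter n) :
    IsColoring (letterPieces t a + straightPieces t a.index) g ↔
      columnLabels n g (t + 1) = a.act (columnLabels n g t) := by
  have hs : IsColoring (straightPieces t a.index) g ↔ ∀ j, j ≠ a.index.castSucc →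
      j ≠ a.index.succ → columnLabels n g (t + 1) j = columnLabels n g t j := by
    simp only [IsColoring, straightPieces, Multiset.mem_map, Finset.mem_val, Finset.mem_erase,
      Finset.mem_univ, and_true, forall_exists_index, and_imp]
    constructor
    · intro h j h1 h2
      exact (h _ j h2 h1 rfl : g (braidEdge t j) = g (braidEdge (t + 1) j)).symm
    · rintro h _ j h2 h1 rfl
      exact (h j h1 h2).symm
  have hne : a.index.castSucc ≠ a.index.succ := (Fin.castSucc_lt_succ (i := a.index)).ne
  have hl : IsColoring (letterPieces t a) g ↔
      columnLabels n g (t + 1) a.index.castSucc =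
        a.act (columnLabels n g t) a.index.castSucc ∧
      columnLabels n g (t + 1) a.index.succ = a.act (columnLabels n g t) a.index.succ := by
    cases a with
    | sigma i =>
      have hne : i.castSucc ≠ i.succ := hne
      simp only [IsColoring, letterPieces, Multiset.mem_singleton, forall_eq, Piece.IsColored,
        BraidLetter.act, BraidLetter.index, columnLabels, Function.update_self,
        Function.update_of_ne hne.symm]
      constructor
      · rintro ⟨h1, h2⟩; exact ⟨by rw [h2, h1], h1⟩
      · rintro ⟨h1, h2⟩; exact ⟨h2, by rw [h1, h2]⟩
    | sigmaInv i =>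
      have hne : i.castSucc ≠ i.succ := hne
      simp only [IsColoring, letterPieces, Multiset.mem_singleton, forall_eq, Piece.IsColored,
        BraidLetter.act, BraidLetter.index, columnLabels, Function.update_self,
        Function.update_of_ne hne]
      constructor
      · rintro ⟨h1, h2⟩; exact ⟨h1.symm, h2⟩
      · rintro ⟨h1, h2⟩; exact ⟨h1.symm, h2⟩
    | tau i =>
      have hne : i.castSucc ≠ i.succ := hne
      simp only [IsColoring, letterPieces, Multiset.insert_eq_cons, Multiset.mem_cons,
        Multiset.mem_singleton, forall_eq_or_imp, forall_eq, Piece.IsColored,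
        BraidLetter.act, BraidLetter.index, columnLabels, Function.update_self,
        Function.update_of_ne hne]
      constructor
      · rintro ⟨h1, h2⟩; exact ⟨h2.symm, h1.symm⟩
      · rintro ⟨h1, h2⟩; exact ⟨h2.symm, h1.symm⟩
  have hact : ∀ j, j ≠ a.index.castSucc → j ≠ a.index.succ →
      a.act (columnLabels n g t) j = columnLabels n g t j := by
    intro j h1 h2
    cases a <;>
    · simp only [BraidLetter.index] at h1 h2
      simp only [BraidLetter.act, Function.update_of_ne h1, Function.update_of_ne h2]
  rw [isColoring_add, hl, hs]
  constructor
  · rintro ⟨⟨h1, h2⟩, h3⟩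
    funext j
    by_cases hj1 : j = a.index.castSucc
    · rw [hj1, h1]
    by_cases hj2 : j = a.index.succ
    · rw [hj2, h2]
    rw [h3 j hj1 hj2, hact j hj1 hj2]
  · intro h
    rw [h]
    exact ⟨⟨rfl, rfl⟩, hact⟩

/-- A colouring is propagated column by column from its first column; the closing joints add one
condition. In the induction on a tail of the word these joints still lead to column `0`, not to
column `t`. -/
theorem isColoring_closurePieces {g : ℕ → G} (w : List (BraidLetter n)) (t : ℕ) :
    IsColoring (closurePieces t w) g ↔
      (∀ s ≤ w.length, columnLabels n g (t + s) =
        (w.take s).foldl BraidLetter.act (columnLabels n g t)) ∧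
      w.foldl BraidLetter.act (columnLabels n g t) = columnLabels n g 0 := by
  induction w generalizing t with
  | nil =>
    simp only [closurePieces, IsColoring, Multiset.mem_map, Finset.mem_val, Finset.mem_univ,
      true_and, forall_exists_index, forall_apply_eq_imp_iff, List.length_nil, Nat.le_zero_eq,
      forall_eq, List.take_nil, List.foldl_nil, Nat.add_zero, true_and]
    exact funext_iff.symm
  | cons a w ih =>
    rw [closurePieces, isColoring_add, isColoring_layer, ih]
    constructor
    · rintro ⟨h1, h2, h3⟩
      refine ⟨fun s hs => ?_, by rw [List.foldl_cons, ← h1, h3]⟩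
      cases s with
      | zero => rfl
      | succ s =>
        have := h2 s (by simpa using hs)
        rw [List.take_succ_cons, List.foldl_cons, ← h1, ← this]
        congr 1; omega
    · rintro ⟨h1, h2⟩
      have h3 : columnLabels n g (t + 1) = a.act (columnLabels n g t) := by
        simpa using h1 1 (by simp)
      refine ⟨h3, fun s hs => ?_, by rw [h3]; exact h2⟩
      have := h1 (s + 1) (by simpa using hs)
      rw [List.take_succ_cons, List.foldl_cons, ← h3] at this
      rw [← this]
      congr 1; omega

/-- The edges of a closed braid. -/
theorem mem_edgeEnds_closure {w : List (BraidLetter n)} {e : ℕ} :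
    e ∈ edgeEnds (closure w).pieces ↔ ∃ t ≤ w.length, ∃ j : Fin (n + 1), e = braidEdge t j := by
  have h : edgeEnds (closure w).pieces = columns n 0 w.length + columns n 0 w.length :=
    add_right_cancel (edgeEnds_closurePieces w 0)
  have hc : ∀ k t, e ∈ columns n t k ↔ ∃ s ≤ k, ∃ j : Fin (n + 1), e = braidEdge (t + s) j := by
    have hcol : ∀ t, e ∈ column n t ↔ ∃ j : Fin (n + 1), e = braidEdge t j := by
      intro t
      simp only [column, Multiset.mem_map, Finset.mem_val, Finset.mem_univ, true_and, eq_comm]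
    intro k
    induction k with
    | zero => intro t; simp [columns, hcol]
    | succ k ih =>
      intro t
      rw [columns, Multiset.mem_add, ih, hcol]
      constructor
      · rintro (⟨j, rfl⟩ | ⟨s, hs, j, rfl⟩)
        · exact ⟨0, by omega, j, rfl⟩
        · exact ⟨s + 1, by omega, j, by rw [show t + 1 + s = t + (s + 1) by omega]⟩
      · rintro ⟨s, hs, j, rfl⟩
        cases s with
        | zero => exact Or.inl ⟨j, rfl⟩
        | succ s =>
          exact Or.inr ⟨s, by omega, j, by rw [show t + 1 + s = t + (s + 1) by omega]⟩
  rw [h, Multiset.mem_add, or_self, hc]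
  simp

/-- The core group of the closure of a braid is presented by the initial labels, which are
identified with the terminal ones. -/
theorem coreGroup_closure (w : List (BraidLetter n)) (R : Set (FreeGroup (Fin (n + 1))))
    (hR : ∀ (A : Type) [Group A] (f : Fin (n + 1) → A),
      (∀ r ∈ R, FreeGroup.lift f r = 1) ↔ ∀ j, FreeGroup.lift f (terminalLabels w j) = f j) :
    Nonempty (CoreGroup (closure w) ≃* PresentedGroup R) := by
  have hgen := (isColoring_closurePieces w 0).1 (closure w).isColoring_gen
  have h1 : ∀ r ∈ R, FreeGroup.lift (columnLabels n (closure w).gen 0) r = 1 := by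
    rw [hR]
    intro j
    have := hgen.2
    rw [foldl_act_eq] at this
    exact congrFun this j
  let x : Fin (n + 1) → PresentedGroup R := PresentedGroup.of
  have hx : ∀ j, FreeGroup.lift x (terminalLabels w j) = x j := by
    rw [← hR]
    intro r hr
    have h : FreeGroup.lift x = PresentedGroup.mk R := by ext j; simp [x, PresentedGroup.of]
    rw [h]
    exact PresentedGroup.one_of_mem hr
  -- The edge number `t * (n + 1) + j` is decoded by division into its column `t` and position `j`;
  -- its label is the one propagated from the generators through `t` letters.
  let g : ℕ → PresentedGroup R := fun e => (w.take (e / (n + 1))).foldl BraidLetter.act x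
    ⟨e % (n + 1), Nat.mod_lt _ n.succ_pos⟩
  have hg : ∀ t, columnLabels n g t = (w.take t).foldl BraidLetter.act x := by
    intro t
    funext j
    have hj1 : (t * (n + 1) + (j : ℕ)) / (n + 1) = t := by
      rw [add_comm, Nat.add_mul_div_right _ _ n.succ_pos, Nat.div_eq_of_lt j.2, zero_add]
    have hj2 : (t * (n + 1) + (j : ℕ)) % (n + 1) = j := by
      rw [add_comm, Nat.add_mul_mod_self_right, Nat.mod_eq_of_lt j.2]
    simp only [columnLabels, g, braidEdge, hj1, hj2]
  have hcol : IsColoring (closure w).pieces g := by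
    refine (isColoring_closurePieces w 0).2 ⟨fun s _ => ?_, ?_⟩
    · rw [hg, hg, zero_add]; rfl
    · rw [hg, List.take_zero, List.foldl_nil, foldl_act_eq]
      exact funext hx
  refine ⟨MonoidHom.toMulEquiv hcol.hom (PresentedGroup.toGroup h1)
    (CoreGroup.hom_ext fun e he => ?_) (PresentedGroup.ext fun j => ?_)⟩
  · obtain ⟨t, ht, j, rfl⟩ := mem_edgeEnds_closure.1 he
    rw [MonoidHom.comp_apply, hcol.hom_gen he, MonoidHom.id_apply]
    have h2 : PresentedGroup.toGroup h1 ∘ x = columnLabels n (closure w).gen 0 :=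
      funext fun j => PresentedGroup.toGroup.of h1
    have h3 := hgen.1 t ht
    rw [zero_add, ← h2, map_foldl_act, ← hg] at h3
    exact (congrFun h3 j).symm
  · have hm : braidEdge 0 j ∈ edgeEnds (closure w).pieces :=
      mem_edgeEnds_closure.2 ⟨0, Nat.zero_le _, j, rfl⟩
    rw [MonoidHom.comp_apply, PresentedGroup.toGroup.of, columnLabels, hcol.hom_gen hm]
    exact congrFun (hg 0) j

end Braid

/-! ### Closures of braids with terminal labels `x₁, x₂, Q₃, x₄` -/

theorem coreGroup_closure_labelsB {w : List (BraidLetter 3)} (hw : terminalLabels w = labelsB) :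
    Nonempty (CoreGroup (closure w) ≃* PresentedGroup {Q₃ * (FreeGroup.of 2)⁻¹}) := by
  refine coreGroup_closure w _ fun A _ f => ?_
  -- The closing equations at the first, second and fourth strands are trivial.
  simp [hw, labelsB, Fin.forall_fin_succ, mul_inv_eq_one]

theorem burnside₂_closure_labelsB {w : List (BraidLetter 3)} (hw : terminalLabels w = labelsB)
    (p : ℕ) : Nonempty (BurnsideGroup₂ p (closure w) ≃* Multiplicative (Fin 4 → ZMod p)) := by
  obtain ⟨e⟩ := coreGroup_closure_labelsB hw
  refine burnside₂_mulEquiv e fun A _ f r hr => ?_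
  rw [Set.mem_singleton_iff.1 hr]
  exact lift_Q₃_comm f

theorem not_nMoveTrivial_closure_labelsB {w : List (BraidLetter 3)}
    (hw : terminalLabels w = labelsB) {p : ℕ} (hp : p.Prime) (hodd : Odd p) :
    ¬ NMoveTrivial p (closure w) := by
  rintro ⟨k, h⟩
  obtain ⟨e⟩ := coreGroup_closure_labelsB hw
  obtain ⟨e₂⟩ := burnside₂_closure_labelsB hw p
  have : Fact p.Prime := ⟨hp⟩
  obtain rfl := rank_eq_of_nMoveEquiv hp e₂ h
  rw [← pow_one p] at h
  have hs := isSymmetricForm_of_nMoveEquiv hp e h (Set.mem_singleton _)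
  rw [pow_one] at hs
  obtain ⟨h1, h2⟩ := coeff_magnus_Q₃ p
  have hv : ∀ a b c, ((magnus p 4 (Q₃ * (FreeGroup.of 2)⁻¹) : NCSeries (Fin 4) (ZMod p)) - 1)
      [a, b, c] = NCSeries.coeff [a, b, c]
        (magnus p 4 (Q₃ * (FreeGroup.of 2)⁻¹) : NCSeries (Fin 4) (ZMod p)) := by
    intro a b c
    rw [NCSeries.sub_apply, NCSeries.one_cons, sub_zero]; rfl
  have h3 : 3 ≤ p := by
    obtain ⟨j, rfl⟩ := hodd
    have := hp.two_le
    omega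
  -- For `p = 3` the two coefficients violate symmetry in degree `p`; for `p > 3` a nonzero term in
  -- degree 3 is already too low.
  rcases h3.eq_or_lt with h3 | h3
  · have := hs.perm [3, 1, 2] [3, 2, 1] (by simp [← h3]) (by decide)
    rw [hv, hv, h1, h2] at this
    exact one_ne_zero this
  · have := hs.order [3, 1, 2] (by simpa using h3)
    rw [hv, h1] at this
    exact one_ne_zero this

end Welded

theorem mainTheorem5 :
    -- the associated core group is an invariant of welded links, and the unreduced `n`-th Burnside
    -- group is invariant under `n`-moves
    (∀ D D' : Welded.Diagram, Welded.WeldedEquiv D D' →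
      Nonempty (Welded.CoreGroup D ≃* Welded.CoreGroup D')) ∧
    (∀ (n : ℕ) (D D' : Welded.Diagram), 0 < n → Welded.NMoveEquiv n D D' →
      Nonempty (Welded.BurnsideGroup n D ≃* Welded.BurnsideGroup n D')) ∧
    -- the obstruction to `p`-move triviality
    (∀ (p : ℕ), p.Prime → ∀ (D : Welded.Diagram) (m : ℕ) (R : Set (FreeGroup (Fin m))),
      Nonempty (Welded.CoreGroup D ≃* PresentedGroup R) →
      Nonempty (Welded.BurnsideGroup₂ p D ≃* Multiplicative (Fin m → ZMod p)) →
      Welded.NMoveTrivial p D →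
      ∀ r ∈ R, HasSymmetricLeadingForm p (magnus p m r : NCSeries (Fin m) (ZMod p))) ∧
    -- the obstruction to `4`-move triviality
    (∀ (D : Welded.Diagram) (m : ℕ) (R : Set (FreeGroup (Fin m))),
      D.numComponents = m →
      Nonempty (Welded.CoreGroup D ≃* PresentedGroup R) →
      Welded.NMoveTrivial 4 D →
      ∀ r ∈ R, HasSymmetricLeadingForm 4 (magnus 2 m r : NCSeries (Fin m) (ZMod 2))) ∧
    -- the welded braid `b`, and the closure of any welded `4`-braid with the same labels
    Welded.terminalLabels Welded.braidB = Welded.labelsB ∧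
    (∀ β : List (Welded.BraidLetter 3), Welded.terminalLabels β = Welded.labelsB →
      Nonempty (Welded.CoreGroup (Welded.closure β) ≃*
        PresentedGroup {Welded.Q₃ * (FreeGroup.of 2)⁻¹}) ∧
      ∀ p : ℕ, p.Prime → Odd p →
        Nonempty (Welded.BurnsideGroup₂ p (Welded.closure β) ≃*
          Multiplicative (Fin 4 → ZMod p)) ∧
        ¬ Welded.NMoveTrivial p (Welded.closure β)) ∧
    -- the asymmetric coefficients of `X₄X₂X₃` and `X₄X₃X₂`
    (∀ p : ℕ, p.Prime → Odd p →
      NCSeries.coeff [3, 1, 2] (magnus p 4 (Welded.Q₃ * (FreeGroup.of 2)⁻¹) :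
        NCSeries (Fin 4) (ZMod p)) = 1 ∧
      NCSeries.coeff [3, 2, 1] (magnus p 4 (Welded.Q₃ * (FreeGroup.of 2)⁻¹) :
        NCSeries (Fin 4) (ZMod p)) = 0) := by
  refine ⟨fun D D' h => h.coreGroup, fun n D D' _ h => h.burnside, ?_, ?_,
    Welded.terminalLabels_braidB, fun β hβ => ⟨Welded.coreGroup_closure_labelsB hβ,
      fun p hp hodd => ⟨Welded.burnside₂_closure_labelsB hβ p,
        Welded.not_nMoveTrivial_closure_labelsB hβ hp hodd⟩⟩,
    fun p _ _ => Welded.coeff_magnus_Q₃ p⟩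
  · rintro p hp D m R ⟨e⟩ ⟨e₂⟩ ⟨k, h⟩ r hr
    obtain rfl := Welded.rank_eq_of_nMoveEquiv hp e₂ h
    rw [← pow_one p] at h
    have hs := Welded.isSymmetricForm_of_nMoveEquiv hp e h hr
    rw [pow_one] at hs
    exact hs.hasSymmetricLeadingForm
  · rintro D m R hD ⟨e⟩ ⟨k, h⟩ r hr
    -- The rank is matched through the number of components, which applies because `4` is even; the
    -- Magnus argument is then used with `4 = 2 ^ 2`.
    have hk : k = m := (Welded.numComponents_eq (by decide) h).symm.trans hD
    subst hk
    exact (Welded.isSymmetricForm_of_nMoveEquiv (p := 2) (a := 2) Nat.prime_two e h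
      hr).hasSymmetricLeadingForm
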